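/- Fix an integer $d\ge 2$ and a real $\alpha>0$. There is a constant $c_5>0$, depending only on $\alpha$ and $d$, such that the following holds for all integers $n\ge 1$ and $k$, all reals $0\le q_n<p_n\le 1$ with $n\binom{n-2}{d-2}p_n\ge\alpha\log n$, and every assignment $\Phi^*:[n]\to[k]$ of the nodes to $k$ communities. Let $\mathcal E$ be the set of all $d$-element subsets of $[n]=\{1,\dots,n\}$, and let $(W_e)_{e\in\mathcal E}$ be independent random weights with values in $[0,1]$ such that $\mathbb E[W_e]=p_n$ if $\Phi^*$ is constant on $e$, and $\mathbb E[W_e]=q_n$ otherwise (the assortative weighted $d$-uniform hypergraph stochastic block model; the distributions of the weights are otherwise arbitrary). Let $\mathbf A$ be the similarity matrix, i.e. the $n\times n$ random matrix with $\mathbf A_{ij}=\sum_{e\in\mathcal E:\{i,j\}\subseteq e}W_e$ for $i\ne j$ and $\mathbf A_{ii}=0$. Then, with $\|\cdot\|$ the spectral norm (the operator norm with respect to the Euclidean norm on $\mathbb R^n$), $$\mathbb P\Big\{\|\mathbf A-\mathbb E[\mathbf A]\|\le c_5\sqrt{n\tbinom{n-2}{d-2}p_n}\Big\}>1-4n^{-11}.$$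 (For $n=1$, where the assertion is trivial, $\binom{n-2}{d-2}$ is read as $\binom{0}{d-2}$.) -/

import Mathlib

open MeasureTheory ProbabilityTheory

namespace WHSBM

/-- The `d`-element subsets of the vertex set `Fin n`. -/
abbrev Edge (n d : ℕ) : Type := {e : Finset (Fin n) // e.card = d}

/-- An edge is homogeneous for `Φ` if all of its nodes lie in the same community. -/
def IsHomogeneous {n d k : ℕ} (Φ : Fin n → Fin k) (e : Edge n d) : Prop :=
  ∀ i ∈ e.1, ∀ j ∈ e.1, Φ i = Φ j

/-- The family `W` of random edge weights on the probability space `(Ω, P)` is a sample of the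
weighted `d`-uniform hypergraph stochastic block model with parameters `n, k, p, q, Φ`. Only the
expectations of the weights are prescribed, not their distributions, which may differ from edge
to edge. -/
structure IsSample {n d k : ℕ} {Ω : Type*} [MeasurableSpace Ω] (P : Measure Ω)
    (p q : ℝ) (Φ : Fin n → Fin k) (W : Edge n d → Ω → ℝ) : Prop where
  measurable : ∀ e, Measurable (W e)
  mem_Icc : ∀ e, ∀ᵐ ω ∂P, W e ω ∈ Set.Icc (0 : ℝ) 1
  indep : iIndepFun W P
  mean_homogeneous : ∀ e, IsHomogeneous Φ e → ∫ ω, W e ω ∂P = p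
  mean_heterogeneous : ∀ e, ¬ IsHomogeneous Φ e → ∫ ω, W e ω ∂P = q

/-- The similarity matrix of the weighted hypergraph with edge weights `w`: the `(i, j)` entry
is the total weight of the edges that contain both `i` and `j` if `i ≠ j`, and `0` if `i = j`. -/
def similarityMatrix {n d : ℕ} (w : Edge n d → ℝ) : Matrix (Fin n) (Fin n) ℝ :=
  Matrix.of fun i j => if i = j then 0 else ∑ e : Edge n d with {i, j} ⊆ e.1, w e

/-- The entrywise expectation of a random matrix. -/
noncomputable def expectedMatrix {n : ℕ} {Ω : Type*} [MeasurableSpace Ω] (P : Measure Ω)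
    (A : Ω → Matrix (Fin n) (Fin n) ℝ) : Matrix (Fin n) (Fin n) ℝ :=
  Matrix.of fun i j => ∫ ω, A ω i j ∂P

/-- The spectral norm of a real square matrix: the operator norm with respect to the Euclidean
norm. -/
noncomputable def spectralNorm {n : ℕ} (M : Matrix (Fin n) (Fin n) ℝ) : ℝ :=
  ‖Matrix.toEuclideanCLM (n := Fin n) (𝕜 := ℝ) M‖

end WHSBM

/-! One edge feeds d(d-1) entries of the similarity matrix, so its entries are dependent. Listing
the vertices of every edge in increasing order and fixing two positions a ≠ b gives a matrix to
which each edge contributes exactly once; the similarity matrix is the sum of these matrices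
(`similarityMatrix_eq_sum`). A bound for each of them therefore costs only a factor d².

For one position pair the argument is that of Kahn and Szemerédi. Let D be the quantity under the
square root. `exists_four_pow_near` picks 4 ^ ρ comparable to D, at least D and at least log n; the
target is then a norm of order 2 ^ ρ. By `spectralNorm_le_of_lattice` it suffices to test integer
vectors z, w of square norm at most 16n, of which there are at most exp(18n). Light entries, |z_i
w_j| ≤ 2 ^ ρ, are controlled by a Chernoff bound strong enough for a union over all z, w
(`measureReal_light_le`).

On heavy entries the mean is small by a second-moment bound. The random part is bounded
deterministically by `sum_heavy_le`, from bounded degrees and a discrepancy property for pairs of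
dyadic level sets. That property is a Chernoff bound whose parameter depends only on the two level
indices (`measureReal_cut_le`), and `levelCost` pays for the union over all sets. Each position pair
fails with probability at most 12 n^(-r); r = 2d + 13 absorbs the factor d². -/

namespace WHSBM

/-! ### Exponential moments of bounded weights -/

section Chernoff

variable {Ω : Type*} [MeasurableSpace Ω] {P : Measure Ω} [IsProbabilityMeasure P]

lemma integrable_exp_mul_of_mem_Icc {X : Ω → ℝ} (hX : Measurable X)
    (h : ∀ᵐ ω ∂P, X ω ∈ Set.Icc (0 : ℝ) 1) (a : ℝ) :
    Integrable (fun ω => Real.exp (a * X ω)) P := by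
  refine Integrable.of_bound (by fun_prop) (Real.exp |a|) ?_
  filter_upwards [h] with ω hω
  rw [Real.norm_eq_abs, Real.abs_exp, Real.exp_le_exp]
  calc a * X ω ≤ |a * X ω| := le_abs_self _
    _ = |a| * X ω := by rw [abs_mul, abs_of_nonneg hω.1]
    _ ≤ |a| * 1 := by gcongr; exact hω.2
    _ = |a| := mul_one _

/-- Convexity gives exp(ax) ≤ 1 + x(exp a - 1) on [0, 1], and 1 + y ≤ exp y finishes. Only the mean
of the weight enters, so its distribution may be arbitrary. -/
lemma integral_exp_mul_le_of_mem_Icc {X : Ω → ℝ} (hX : Measurable X)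
    (h : ∀ᵐ ω ∂P, X ω ∈ Set.Icc (0 : ℝ) 1) (a : ℝ) :
    ∫ ω, Real.exp (a * X ω) ∂P ≤ Real.exp ((∫ ω, X ω ∂P) * (Real.exp a - 1)) := by
  have hXi : Integrable X P := Integrable.of_mem_Icc 0 1 hX.aemeasurable h
  have key : ∫ ω, Real.exp (a * X ω) ∂P ≤ ∫ ω, (1 + X ω * (Real.exp a - 1)) ∂P := by
    refine integral_mono_ae (integrable_exp_mul_of_mem_Icc hX h a)
      ((integrable_const _).add (hXi.mul_const _)) ?_
    filter_upwards [h] with ω hω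
    have := convexOn_exp.2 (Set.mem_univ a) (Set.mem_univ 0) hω.1 (sub_nonneg.2 hω.2) (by ring)
    simp only [smul_eq_mul, mul_zero, add_zero, Real.exp_zero, mul_one] at this
    rw [mul_comm a]
    show Real.exp (X ω * a) ≤ 1 + X ω * (Real.exp a - 1)
    linarith
  rw [integral_add (integrable_const _) (hXi.mul_const _), integral_mul_const] at key
  simp only [integral_const, probReal_univ, smul_eq_mul, mul_one] at key
  refine key.trans ?_
  rw [add_comm]
  exact Real.add_one_le_exp _

/-- Chernoff bound for a linear combination of independent weights with values in `[0, 1]`. -/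
lemma measureReal_le_sum_mul_le_exp {ι : Type*} [Fintype ι] {W : ι → Ω → ℝ}
    (hW : ∀ e, Measurable (W e)) (h : ∀ e, ∀ᵐ ω ∂P, W e ω ∈ Set.Icc (0 : ℝ) 1)
    (hind : iIndepFun W P) (a : ι → ℝ) (τ : ℝ) :
    P.real {ω | τ ≤ ∑ e, a e * W e ω} ≤
      Real.exp (∑ e, (∫ ω, W e ω ∂P) * (Real.exp (a e) - 1) - τ) := by
  have hX : ∀ e, Measurable fun ω => a e * W e ω := fun e => (hW e).const_mul _
  have hi : iIndepFun (fun e ω => a e * W e ω) P :=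
    hind.comp (fun e x => a e * x) fun e => measurable_const_mul _
  have hint := hi.integrable_exp_mul_sum (t := 1) hX (s := Finset.univ) (fun e _ => by
    simpa using integrable_exp_mul_of_mem_Icc (hW e) (h e) (a e))
  have hc := measure_ge_le_exp_mul_mgf τ zero_le_one hint
  rw [hi.mgf_sum hX] at hc
  simp only [Finset.sum_apply] at hc
  refine hc.trans ?_
  rw [sub_eq_neg_add, Real.exp_add, Real.exp_sum, neg_one_mul]
  gcongr with e
  · exact fun _ _ => mgf_nonneg
  · simpa [mgf] using integral_exp_mul_le_of_mem_Icc (hW e) (h e) (a e)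

end Chernoff

/-! ### Discretisation of the unit ball by integer vectors -/

section Lattice

variable {n : ℕ}

lemma exists_int_abs_le_abs_sub_le (a : ℝ) : ∃ z : ℤ, |(z : ℝ)| ≤ |a| ∧ |a - z| ≤ 1 := by
  rcases le_total 0 a with ha | ha
  · refine ⟨⌊a⌋, ?_, ?_⟩
    · rw [abs_of_nonneg ha, abs_of_nonneg (by exact_mod_cast Int.floor_nonneg.2 ha)]
      exact Int.floor_le a
    · rw [abs_le]
      constructor <;> linarith [Int.floor_le a, Int.lt_floor_add_one a]
  · refine ⟨⌈a⌉, ?_, ?_⟩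
    · rw [abs_of_nonpos ha, abs_of_nonpos (by exact_mod_cast Int.ceil_nonpos.2 ha)]
      linarith [Int.le_ceil a]
    · rw [abs_le]
      constructor <;> linarith [Int.le_ceil a, Int.ceil_lt_add_one a]

/-- Round 4√n · x towards zero in each coordinate: the norm does not grow, and n errors of at most
1/(4√n) add up to 1/4 in Euclidean norm. -/
lemma exists_lattice_approx (hn : 1 ≤ n) (x : EuclideanSpace ℝ (Fin n)) (hx : ‖x‖ ≤ 1) :
    ∃ z : Fin n → ℤ, ∑ i, z i ^ 2 ≤ 16 * n ∧
      ‖x - (4 * √(n : ℝ))⁻¹ • WithLp.toLp 2 (fun i => (z i : ℝ))‖ ≤ 1 / 4 ∧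
      ‖(4 * √(n : ℝ))⁻¹ • (WithLp.toLp 2 (fun i => (z i : ℝ)) : EuclideanSpace ℝ (Fin n))‖ ≤ 1 := by
  have hn' : (0 : ℝ) < n := by exact_mod_cast hn
  set c : ℝ := 4 * √(n : ℝ) with hc
  have hc0 : 0 < c := by positivity
  have hc2 : c ^ 2 = 16 * n := by rw [hc, mul_pow, Real.sq_sqrt hn'.le]; norm_num
  choose z hz1 hz2 using fun i => exists_int_abs_le_abs_sub_le (c * x i)
  have hxs : ∑ i, x i ^ 2 ≤ 1 := by
    have := EuclideanSpace.real_norm_sq_eq x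
    rw [← this]
    nlinarith [norm_nonneg x]
  have hzs : ∑ i, (z i : ℝ) ^ 2 ≤ 16 * n := by
    calc ∑ i, (z i : ℝ) ^ 2 ≤ ∑ i, (c * x i) ^ 2 :=
          Finset.sum_le_sum fun i _ => sq_le_sq.2 (hz1 i)
      _ = c ^ 2 * ∑ i, x i ^ 2 := by rw [Finset.mul_sum]; simp_rw [mul_pow]
      _ ≤ c ^ 2 * 1 := by gcongr
      _ = 16 * n := by rw [hc2, mul_one]
  refine ⟨z, by exact_mod_cast hzs, ?_, ?_⟩
  · refine abs_le_of_sq_le_sq' ?_ (by norm_num) |>.2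
    rw [EuclideanSpace.real_norm_sq_eq]
    have : ∀ i, (x - c⁻¹ • WithLp.toLp 2 (fun i => (z i : ℝ)) : EuclideanSpace ℝ (Fin n)) i ^ 2
        ≤ (c ^ 2)⁻¹ := by
      intro i
      have h1 : (x - c⁻¹ • WithLp.toLp 2 (fun i => (z i : ℝ)) : EuclideanSpace ℝ (Fin n)) i
          = c⁻¹ * (c * x i - z i) := by
        simp only [PiLp.sub_apply, PiLp.smul_apply, smul_eq_mul]
        field_simp
      rw [h1, mul_pow, inv_pow]
      have h2 : (c * x i - z i) ^ 2 ≤ 1 := by rw [sq_le_one_iff_abs_le_one]; exact hz2 i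
      have h3 : 0 ≤ (c ^ 2)⁻¹ := by positivity
      nlinarith
    calc _ ≤ ∑ _i : Fin n, (c ^ 2)⁻¹ := Finset.sum_le_sum fun i _ => this i
      _ = (1 / 4) ^ 2 := by
        rw [hc2]; simp; field_simp; norm_num
  · refine abs_le_of_sq_le_sq' ?_ (by norm_num) |>.2
    rw [EuclideanSpace.real_norm_sq_eq]
    simp only [PiLp.smul_apply, smul_eq_mul, mul_pow, ← Finset.mul_sum, inv_pow]
    rw [hc2, one_pow, inv_mul_le_iff₀ (by positivity), mul_one]
    exact hzs

/-- Testing a matrix on integer vectors of square norm at most `16 n` controls its spectral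
norm. -/
lemma spectralNorm_le_of_lattice (hn : 1 ≤ n) (M : Matrix (Fin n) (Fin n) ℝ) {K : ℝ}
    (h : ∀ z w : Fin n → ℤ, ∑ i, z i ^ 2 ≤ 16 * n → ∑ i, w i ^ 2 ≤ 16 * n →
      ∑ i, ∑ j, M i j * z i * w j ≤ K * n) :
    spectralNorm M ≤ K / 8 := by
  have hn' : (0 : ℝ) < n := by exact_mod_cast hn
  unfold spectralNorm
  set T := Matrix.toEuclideanCLM (n := Fin n) (𝕜 := ℝ) M with hT
  have hK : 0 ≤ K := by
    have := h 0 0 (by simp) (by simp)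
    simp only [Pi.zero_apply, Int.cast_zero, mul_zero, Finset.sum_const_zero] at this
    exact nonneg_of_mul_nonneg_left this hn'
  -- Replacing x and y by lattice points costs ‖T‖/4 each. The total ‖T‖/2 is absorbed on the left
  -- once x is taken in the direction of T y.
  have hB : ∀ x y : EuclideanSpace ℝ (Fin n), ‖x‖ ≤ 1 → ‖y‖ ≤ 1 →
      inner ℝ x (T y) ≤ K / 16 + ‖T‖ / 2 := by
    intro x y hx hy
    obtain ⟨z, hz, hz1, hz2⟩ := exists_lattice_approx hn x hx
    obtain ⟨w, hw, hw1, hw2⟩ := exists_lattice_approx hn y hy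
    set c : ℝ := 4 * √(n : ℝ) with hc
    have hc0 : 0 < c := by positivity
    have hc2 : c ^ 2 = 16 * n := by rw [hc, mul_pow, Real.sq_sqrt hn'.le]; norm_num
    set x' : EuclideanSpace ℝ (Fin n) := c⁻¹ • WithLp.toLp 2 (fun i => (z i : ℝ))
    set y' : EuclideanSpace ℝ (Fin n) := c⁻¹ • WithLp.toLp 2 (fun i => (w i : ℝ))
    have e : inner ℝ x (T y) =
        inner ℝ x' (T y') + inner ℝ (x - x') (T y') + inner ℝ x (T (y - y')) := by
      rw [map_sub, inner_sub_left, inner_sub_right]; ring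
    have h1 : inner ℝ x' (T y') ≤ K / 16 := by
      have : inner ℝ x' (T y') = (c ^ 2)⁻¹ * ∑ i, ∑ j, M i j * z i * w j := by
        simp only [x', y', map_smul, inner_smul_left, inner_smul_right, hT,
          Matrix.inner_toEuclideanCLM]
        simp only [dotProduct, Matrix.mulVec, Finset.mul_sum, conj_trivial]
        refine Finset.sum_congr rfl fun i _ => Finset.sum_congr rfl fun j _ => ?_
        rw [sq, mul_inv]; ring
      rw [this, hc2, inv_mul_le_iff₀ (by positivity)]
      linarith [h z w hz hw]
    have h2 : inner ℝ (x - x') (T y') ≤ ‖T‖ / 4 := by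
      calc inner ℝ (x - x') (T y') ≤ ‖x - x'‖ * ‖T y'‖ := real_inner_le_norm _ _
        _ ≤ 1 / 4 * (‖T‖ * 1) := by
          gcongr
          exact (T.le_opNorm y').trans (by gcongr)
        _ = ‖T‖ / 4 := by ring
    have h3 : inner ℝ x (T (y - y')) ≤ ‖T‖ / 4 := by
      calc inner ℝ x (T (y - y')) ≤ ‖x‖ * ‖T (y - y')‖ := real_inner_le_norm _ _
        _ ≤ 1 * (‖T‖ * (1 / 4)) := by
          gcongr
          exact (T.le_opNorm _).trans (by gcongr)
        _ = ‖T‖ / 4 := by ring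
    linarith
  have hle : ‖T‖ ≤ K / 16 + ‖T‖ / 2 := by
    refine T.opNorm_le_of_unit_norm (by positivity) fun y hy => ?_
    rcases eq_or_ne (T y) 0 with h0 | h0
    · rw [h0, norm_zero]; positivity
    · have h1 := hB ((‖T y‖)⁻¹ • T y) y (by
        rw [norm_smul, norm_inv, norm_norm, inv_mul_cancel₀ (norm_ne_zero_iff.2 h0)]) hy.le
      rw [inner_smul_left, real_inner_self_eq_norm_sq] at h1
      have : 0 < ‖T y‖ := norm_pos_iff.2 h0
      simp only [conj_trivial] at h1
      rwa [sq, inv_mul_cancel_left₀ this.ne'] at h1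
  linarith

/-- The integer vectors of square norm at most `16 n`. -/
noncomputable def latticeBall (n : ℕ) : Finset (Fin n → ℤ) :=
  (Fintype.piFinset fun _ => Finset.Icc (-(16 * n : ℤ)) (16 * n)).filter
    fun z => ∑ i, z i ^ 2 ≤ 16 * n

lemma mem_latticeBall {z : Fin n → ℤ} : z ∈ latticeBall n ↔ ∑ i, z i ^ 2 ≤ 16 * n := by
  simp only [latticeBall, Finset.mem_filter, Fintype.mem_piFinset, Finset.mem_Icc,
    and_iff_right_iff_imp]
  intro h i
  have h1 : z i ^ 2 ≤ 16 * n :=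
    (Finset.single_le_sum (f := fun i => z i ^ 2) (fun i _ => sq_nonneg _) (Finset.mem_univ i)).trans h
  have h2 : |z i| ≤ z i ^ 2 := by
    rw [← sq_abs]
    exact Int.le_self_sq _
  exact abs_le.1 (h2.trans h1)

lemma sum_exp_neg_sq_le (N : ℕ) :
    ∑ k ∈ Finset.Icc (-(N : ℤ)) N, Real.exp (-(k : ℝ) ^ 2) ≤ Real.exp 2 := by
  have hN : ∑ k ∈ Finset.range N, (1 / 2 : ℝ) ^ (k + 1) ≤ 1 := by
    simp_rw [pow_succ, ← Finset.sum_mul]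
    have := geom_sum_eq (x := (1 / 2 : ℝ)) (by norm_num) N
    rw [this]
    have : (0 : ℝ) ≤ (1 / 2) ^ N := by positivity
    norm_num
    linarith
  have h3 : (3 : ℝ) ≤ Real.exp 2 := by linarith [Real.add_one_le_exp (2 : ℝ)]
  have key : ∑ k ∈ Finset.Icc (-(N : ℤ)) N, Real.exp (-(k : ℝ) ^ 2) ≤
      1 + 2 * ∑ k ∈ Finset.range N, (1 / 2 : ℝ) ^ (k + 1) := by
    clear hN
    induction N with
    | zero => simp
    | succ N ih =>
      have hs : Finset.Icc (-((N + 1 : ℕ) : ℤ)) ((N + 1 : ℕ) : ℤ) =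
          insert (-((N : ℤ) + 1)) (insert ((N : ℤ) + 1) (Finset.Icc (-(N : ℤ)) N)) := by
        ext k
        simp only [Finset.mem_Icc, Finset.mem_insert]
        push_cast
        omega
      have hb : Real.exp (-((N : ℝ) + 1) ^ 2) ≤ (1 / 2) ^ (N + 1) := by
        have h2 : Real.exp (-1) ≤ 1 / 2 := by
          have := Real.exp_neg_one_lt_half
          linarith
        calc Real.exp (-((N : ℝ) + 1) ^ 2) ≤ Real.exp (((N + 1 : ℕ) : ℝ) * (-1)) := by
              rw [Real.exp_le_exp]; push_cast; nlinarith [(Nat.cast_nonneg N : (0 : ℝ) ≤ N)]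
          _ = Real.exp (-1) ^ (N + 1) := Real.exp_nat_mul _ _
          _ ≤ (1 / 2) ^ (N + 1) := by gcongr
      rw [hs, Finset.sum_insert, Finset.sum_insert, Finset.sum_range_succ]
      · have e1 : ((-((N : ℤ) + 1) : ℤ) : ℝ) ^ 2 = ((N : ℝ) + 1) ^ 2 := by push_cast; ring
        have e2 : ((((N : ℤ) + 1) : ℤ) : ℝ) ^ 2 = ((N : ℝ) + 1) ^ 2 := by push_cast; ring
        rw [e1, e2]
        linarith
      · simp
      · simp only [Finset.mem_insert, Finset.mem_Icc]
        omega
  linarith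

/-- Each z in the ball satisfies 1 ≤ exp(16n) ∏ exp(-z_i²). Summed over a box, the product
factorises into n one-dimensional sums, each at most exp 2. -/
lemma card_latticeBall_le (n : ℕ) : ((latticeBall n).card : ℝ) ≤ Real.exp (18 * n) := by
  have h1 : ((latticeBall n).card : ℝ) ≤
      ∑ z ∈ latticeBall n, Real.exp (16 * n) * ∏ i, Real.exp (-(z i : ℝ) ^ 2) := by
    rw [← nsmul_one, ← Finset.sum_const]
    refine Finset.sum_le_sum fun z hz => ?_
    rw [← Real.exp_sum, ← Real.exp_add, Real.one_le_exp_iff, Finset.sum_neg_distrib]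
    have : ((∑ i, z i ^ 2 : ℤ) : ℝ) ≤ ((16 * n : ℤ) : ℝ) := by exact_mod_cast mem_latticeBall.1 hz
    push_cast at this
    linarith
  refine h1.trans ?_
  rw [← Finset.mul_sum]
  calc Real.exp (16 * n) * ∑ z ∈ latticeBall n, ∏ i, Real.exp (-(z i : ℝ) ^ 2)
      ≤ Real.exp (16 * n) * ∑ z ∈ Fintype.piFinset fun _ : Fin n =>
          Finset.Icc (-(16 * n : ℤ)) (16 * n), ∏ i, Real.exp (-(z i : ℝ) ^ 2) := by
        refine mul_le_mul_of_nonneg_left ?_ (Real.exp_nonneg _)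
        exact Finset.sum_le_sum_of_subset_of_nonneg (Finset.filter_subset _ _)
          fun _ _ _ => Finset.prod_nonneg fun _ _ => Real.exp_nonneg _
    _ = Real.exp (16 * n) *
        (∑ k ∈ Finset.Icc (-(16 * n : ℤ)) (16 * n), Real.exp (-(k : ℝ) ^ 2)) ^ n := by
        rw [← Finset.prod_univ_sum (fun _ : Fin n => Finset.Icc (-(16 * n : ℤ)) (16 * n))
          (fun _ k => Real.exp (-(k : ℝ) ^ 2))]
        simp
    _ ≤ Real.exp (16 * n) * Real.exp 2 ^ n := by
        gcongr
        exact_mod_cast sum_exp_neg_sq_le (16 * n)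
    _ = Real.exp (18 * n) := by
        rw [← Real.exp_nat_mul, ← Real.exp_add]; ring_nf

end Lattice

/-! ### Dyadic level sets and sums over pairs of levels -/

section DyadicLevels

variable {n : ℕ}

/-- The total weight of the edges whose endpoints lie in `S` and `T`. -/
def cut {ι : Type*} [Fintype ι] (f g : ι → Fin n) (u : ι → ℝ) (S T : Finset (Fin n)) : ℝ :=
  ∑ e with f e ∈ S ∧ g e ∈ T, u e

/-- The coordinates at which `x` is positive and of size about `2 ^ s`. -/
def level (x : Fin n → ℕ) (s : ℕ) : Finset (Fin n) :=
  {i | x i ≠ 0 ∧ Nat.log 2 (x i) = s}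

/-- The cost, in the union bound, of the set `T` as the level set of index `t`. -/
noncomputable def levelCost (t : ℕ) (T : Finset (Fin n)) : ℝ :=
  T.card * (1 + 4 * t) + n / 16 ^ t

lemma levelCost_nonneg (t : ℕ) (T : Finset (Fin n)) : 0 ≤ levelCost t T := by
  unfold levelCost; positivity

/-- Write log n = t log 16 + log(n / 16 ^ t); the two summands of the cost dominate these in turn.
Multiples of the cost can thus be traded for powers of n. -/
lemma log_le_levelCost (t : ℕ) {T : Finset (Fin n)} (hT : T.Nonempty) :
    Real.log n ≤ levelCost t T := by
  have hn : (0 : ℝ) < n := by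
    obtain ⟨i, -⟩ := hT
    exact_mod_cast i.pos
  have h1 : (1 : ℝ) ≤ T.card := by exact_mod_cast hT.card_pos
  have h2 : Real.log n = t * Real.log 16 + Real.log (n / 16 ^ t) := by
    rw [Real.log_div hn.ne' (by positivity), Real.log_pow]; ring
  have h3 : Real.log 16 ≤ 4 := by
    rw [show (16 : ℝ) = 2 ^ 4 by norm_num, Real.log_pow]
    have := Real.log_two_lt_d9
    norm_num
    linarith
  have h4 : Real.log (n / 16 ^ t) ≤ n / 16 ^ t := Real.log_le_self (by positivity)
  have h5 : (0 : ℝ) ≤ t := t.cast_nonneg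
  unfold levelCost
  rw [h2]
  nlinarith

/-- The sum over sets is exp(-n / 16 ^ t) (1 + exp(-(1 + 4t))) ^ n. Since exp(-(1 + 4t)) ≤ 16 ^
(-t), the term n / 16 ^ t of the cost pays for the number of sets. -/
lemma sum_exp_neg_levelCost_le (n t : ℕ) :
    ∑ T : Finset (Fin n), Real.exp (-levelCost t T) ≤ 1 := by
  have h1 : ∑ T : Finset (Fin n), Real.exp (-levelCost t T) =
      Real.exp (-(n / 16 ^ t)) * (1 + Real.exp (-(1 + 4 * t))) ^ n := by
    have := Finset.prod_one_add (f := fun _ : Fin n => Real.exp (-(1 + 4 * t : ℝ))) Finset.univ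
    simp only [Finset.prod_const, Finset.card_univ, Fintype.card_fin, Finset.powerset_univ] at this
    rw [this, Finset.mul_sum]
    refine Finset.sum_congr rfl fun T _ => ?_
    rw [← Real.exp_nat_mul, ← Real.exp_add, levelCost]
    ring_nf
  have h2 : Real.exp (-(1 + 4 * t : ℝ)) ≤ 1 / 16 ^ t := by
    have h16 : Real.exp (-4) ≤ 1 / 16 := by
      have h := Real.exp_neg_one_lt_half
      have : Real.exp (-4) = Real.exp (-1) ^ 4 := by rw [← Real.exp_nat_mul]; norm_num
      rw [this]
      calc Real.exp (-1) ^ 4 ≤ (1 / 2) ^ 4 := by gcongr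
        _ = 1 / 16 := by norm_num
    calc Real.exp (-(1 + 4 * t : ℝ)) ≤ Real.exp (t * (-4)) := by
          rw [Real.exp_le_exp]; linarith
      _ = Real.exp (-4) ^ t := Real.exp_nat_mul _ _
      _ ≤ (1 / 16) ^ t := by gcongr
      _ = 1 / 16 ^ t := by rw [one_div_pow]
  have h3 : (1 + Real.exp (-(1 + 4 * t : ℝ))) ^ n ≤ Real.exp (n / 16 ^ t) := by
    calc (1 + Real.exp (-(1 + 4 * t : ℝ))) ^ n ≤ Real.exp (1 / 16 ^ t) ^ n := by
          gcongr
          linarith [Real.add_one_le_exp (1 / 16 ^ t : ℝ)]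
      _ = Real.exp (n / 16 ^ t) := by rw [← Real.exp_nat_mul]; ring_nf
  rw [h1]
  calc _ ≤ Real.exp (-(n / 16 ^ t : ℝ)) * Real.exp (n / 16 ^ t) := by gcongr
    _ = 1 := by rw [← Real.exp_add]; simp

lemma sum_level (x : Fin n → ℕ) (L : ℕ) :
    ∑ s ∈ Finset.range L, (4 : ℝ) ^ s * (level x s).card ≤ ∑ i, (x i : ℝ) ^ 2 := by
  have h1 : ∀ s, (4 : ℝ) ^ s * (level x s).card ≤ ∑ i ∈ level x s, (x i : ℝ) ^ 2 := by
    intro s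
    rw [mul_comm, ← nsmul_eq_mul, ← Finset.sum_const]
    refine Finset.sum_le_sum fun i hi => ?_
    simp only [level, Finset.mem_filter, Finset.mem_univ, true_and] at hi
    have : 2 ^ s ≤ x i := hi.2 ▸ Nat.pow_log_le_self 2 hi.1
    have h2 : (2 : ℝ) ^ s ≤ x i := by exact_mod_cast this
    calc (4 : ℝ) ^ s = (2 ^ s) ^ 2 := by rw [← pow_mul, mul_comm, pow_mul]; norm_num
      _ ≤ (x i : ℝ) ^ 2 := by gcongr
  refine (Finset.sum_le_sum fun s _ => h1 s).trans ?_
  rw [← Finset.sum_biUnion]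
  · exact Finset.sum_le_sum_of_subset_of_nonneg (Finset.subset_univ _) fun _ _ _ => sq_nonneg _
  · intro s _ t _ hst
    rw [Function.onFun, Finset.disjoint_left]
    intro i hi hj
    simp only [level, Finset.mem_filter, Finset.mem_univ, true_and] at hi hj
    exact hst (hi.2.symm.trans hj.2)

lemma sum_succ_div_two_pow_le (N : ℕ) :
    ∑ k ∈ Finset.range N, ((k : ℝ) + 1) / 2 ^ k ≤ 4 := by
  have : ∑ k ∈ Finset.range N, ((k : ℝ) + 1) / 2 ^ k = 4 - (2 * N + 4) / 2 ^ N := by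
    induction N with
    | zero => norm_num
    | succ N ih => rw [Finset.sum_range_succ, ih]; push_cast; field_simp; ring
  rw [this]
  have : (0 : ℝ) ≤ (2 * N + 4) / 2 ^ N := by positivity
  linarith

/-- Put k = ρ + t - s and let m + 1 be the denominator. Then m + 1 + k = 2(t + 1), the numerator is
2 ^ ρ 4 ^ t / 2 ^ k, and 1/(m + 1) ≤ (k + 1)/(m + 1 + k). The sum over k converges, and the gain
1/(t + 1) is what later cancels the factor 1 + 4t in `levelCost`. -/
lemma sum_two_pow_div_le (ρ t : ℕ) (F : Finset ℕ) (hF : ∀ s ∈ F, s ≤ ρ + t ∧ ρ ≤ s + t + 1) :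
    ∑ s ∈ F, (2 : ℝ) ^ (s + t) / ((s + t + 2 - ρ : ℕ) : ℝ) ≤ 2 * 2 ^ ρ * (4 ^ t / (t + 1)) := by
  -- The unsimplified ρ + t + 1 - 1 - s is the shape that `Finset.sum_range_reflect` expects.
  have h1 : ∀ s ∈ F, (2 : ℝ) ^ (s + t) / ((s + t + 2 - ρ : ℕ) : ℝ) ≤
      2 ^ ρ * (4 ^ t / (2 * (t + 1))) * ((((ρ + t + 1 - 1 - s : ℕ) : ℝ) + 1) / 2 ^ (ρ + t + 1 - 1 - s)) := by
    intro s hs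
    obtain ⟨ha, hb⟩ := hF s hs
    obtain ⟨m, hm⟩ : ∃ m, s + t + 2 - ρ = m + 1 := ⟨s + t + 1 - ρ, by omega⟩
    obtain ⟨k, hk⟩ : ∃ k, ρ + t + 1 - 1 - s = k := ⟨_, rfl⟩
    rw [hm, hk]
    have e1 : m + 1 + k = 2 * (t + 1) := by omega
    have e2 : ρ + 2 * t = s + t + k := by omega
    have e3 : (2 : ℝ) ^ ρ * 4 ^ t = 2 ^ (s + t) * 2 ^ k := by
      rw [← pow_add, ← e2, pow_add, pow_mul]; norm_num
    have e4 : (2 * ((t : ℝ) + 1)) = m + 1 + k := by exact_mod_cast e1.symm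
    have e5 : (2 : ℝ) ^ ρ * (4 ^ t / (m + 1 + k)) * ((k + 1) / 2 ^ k) =
        2 ^ (s + t) * ((k + 1) / (m + 1 + k)) := by
      calc _ = (2 : ℝ) ^ ρ * 4 ^ t * ((k + 1) / (m + 1 + k) / 2 ^ k) := by ring
        _ = _ := by rw [e3]; field_simp
    rw [e4, e5, div_eq_mul_inv]
    gcongr
    push_cast
    rw [inv_eq_one_div, div_le_div_iff₀ (by positivity) (by positivity)]
    nlinarith [mul_nonneg (Nat.cast_nonneg m : (0 : ℝ) ≤ m) (Nat.cast_nonneg k : (0 : ℝ) ≤ k)]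
  refine (Finset.sum_le_sum h1).trans ?_
  rw [← Finset.mul_sum]
  have h2 : ∑ s ∈ F, (((ρ + t + 1 - 1 - s : ℕ) : ℝ) + 1) / 2 ^ (ρ + t + 1 - 1 - s) ≤ 4 := by
    calc _ ≤ ∑ s ∈ Finset.range (ρ + t + 1),
          (((ρ + t + 1 - 1 - s : ℕ) : ℝ) + 1) / 2 ^ (ρ + t + 1 - 1 - s) := by
          refine Finset.sum_le_sum_of_subset_of_nonneg (fun s hs => ?_) fun _ _ _ => by positivity
          have := (hF s hs).1
          simp; omega
      _ = ∑ k ∈ Finset.range (ρ + t + 1), ((k : ℝ) + 1) / 2 ^ k :=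
          Finset.sum_range_reflect (fun k => ((k : ℝ) + 1) / 2 ^ k) (ρ + t + 1)
      _ ≤ 4 := sum_succ_div_two_pow_le _
  calc _ ≤ 2 ^ ρ * (4 ^ t / (2 * ((t : ℝ) + 1))) * 4 := by gcongr
    _ = 2 * 2 ^ ρ * (4 ^ t / (t + 1)) := by field_simp; norm_num

/-- The pairs of indices of dyadic levels that contribute to the heavy part. -/
def heavyPairs (ρ L : ℕ) : Finset (ℕ × ℕ) :=
  (Finset.range L ×ˢ Finset.range L).filter
    fun p => p.1 ≤ ρ + p.2 ∧ p.2 ≤ ρ + p.1 ∧ ρ ≤ p.1 + p.2 + 1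

lemma mem_heavyPairs {ρ L : ℕ} {p : ℕ × ℕ} : p ∈ heavyPairs ρ L ↔
    (p.1 < L ∧ p.2 < L) ∧ p.1 ≤ ρ + p.2 ∧ p.2 ≤ ρ + p.1 ∧ ρ ≤ p.1 + p.2 + 1 := by
  simp [heavyPairs]

lemma sum_heavyPairs_snd_le (ρ L : ℕ) (c : ℕ → ℝ) (hc : ∀ t, 0 ≤ c t) :
    ∑ p ∈ heavyPairs ρ L, (2 : ℝ) ^ (p.1 + p.2) * c p.2 / ((p.1 + p.2 + 2 - ρ : ℕ) : ℝ) ≤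
      2 * 2 ^ ρ * ∑ t ∈ Finset.range L, 4 ^ t * c t / (t + 1) := by
  rw [← Finset.sum_fiberwise_of_maps_to (t := Finset.range L) (g := Prod.snd)
    (fun p hp => Finset.mem_range.2 (mem_heavyPairs.1 hp).1.2), Finset.mul_sum]
  refine Finset.sum_le_sum fun t _ => ?_
  set F : Finset ℕ := (heavyPairs ρ L |>.filter fun p => p.2 = t).image Prod.fst with hF
  have h1 : ∑ p ∈ heavyPairs ρ L with p.2 = t,
      (2 : ℝ) ^ (p.1 + p.2) * c p.2 / ((p.1 + p.2 + 2 - ρ : ℕ) : ℝ) =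
      c t * ∑ s ∈ F, (2 : ℝ) ^ (s + t) / ((s + t + 2 - ρ : ℕ) : ℝ) := by
    rw [hF, Finset.sum_image, Finset.mul_sum]
    · refine Finset.sum_congr rfl fun p hp => ?_
      rw [(Finset.mem_filter.1 hp).2]; ring
    · rintro ⟨a, b⟩ hp ⟨a', b'⟩ hq h
      have h1 := (Finset.mem_filter.1 hp).2
      have h2 := (Finset.mem_filter.1 hq).2
      simp only at h1 h2 h
      rw [h1, h2, h]
  have h2 := sum_two_pow_div_le ρ t F (fun s hs => by
    obtain ⟨p, hp, rfl⟩ := Finset.mem_image.1 hs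
    obtain ⟨hp1, rfl⟩ := Finset.mem_filter.1 hp
    have := mem_heavyPairs.1 hp1
    exact ⟨this.2.1, this.2.2.2⟩)
  rw [h1]
  calc _ ≤ c t * (2 * 2 ^ ρ * (4 ^ t / (t + 1))) := by gcongr; exact hc t
    _ = _ := by ring

lemma sum_heavyPairs_fst_le (ρ L : ℕ) (c : ℕ → ℝ) (hc : ∀ t, 0 ≤ c t) :
    ∑ p ∈ heavyPairs ρ L, (2 : ℝ) ^ (p.1 + p.2) * c p.1 / ((p.1 + p.2 + 2 - ρ : ℕ) : ℝ) ≤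
      2 * 2 ^ ρ * ∑ t ∈ Finset.range L, 4 ^ t * c t / (t + 1) := by
  refine le_trans (le_of_eq ?_) (sum_heavyPairs_snd_le ρ L c hc)
  refine Finset.sum_nbij' Prod.swap Prod.swap ?_ ?_ ?_ ?_ ?_
  · intro p hp
    rw [mem_heavyPairs] at hp ⊢
    simp only [Prod.fst_swap, Prod.snd_swap]
    omega
  · intro p hp
    rw [mem_heavyPairs] at hp ⊢
    simp only [Prod.fst_swap, Prod.snd_swap]
    omega
  · simp
  · simp
  · intro p _
    simp only [Prod.fst_swap, Prod.snd_swap]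
    rw [add_comm p.2 p.1]

/-- Since (1 + 4t)/(t + 1) ≤ 4, the set sizes contribute at most 4 · 16n; the terms n · 4 ^ t / 16 ^
t form a geometric series of total at most 2n. -/
lemma sum_levelCost_le (x : Fin n → ℕ) (hx : ∑ i, (x i : ℝ) ^ 2 ≤ 16 * n) (L : ℕ) :
    ∑ t ∈ Finset.range L, 4 ^ t * levelCost t (level x t) / (t + 1) ≤ 66 * n := by
  have h1 : ∀ t ∈ Finset.range L, 4 ^ t * levelCost t (level x t) / (t + 1) ≤
      4 * ((4 : ℝ) ^ t * (level x t).card) + n * (1 / 4) ^ t := by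
    intro t _
    have ht : (0 : ℝ) ≤ t := t.cast_nonneg
    rw [div_le_iff₀ (by positivity), levelCost]
    have e : (4 : ℝ) ^ t * (n / 16 ^ t) = n * (1 / 4) ^ t := by
      rw [show (16 : ℝ) = 4 * 4 by norm_num, mul_pow, one_div_pow]; field_simp
    rw [mul_add, e]
    have p1 : 0 ≤ (4 : ℝ) ^ t * (level x t).card := by positivity
    have p2 : 0 ≤ (n : ℝ) * (1 / 4) ^ t := by positivity
    nlinarith [mul_nonneg p1 ht, mul_nonneg p2 ht]
  refine (Finset.sum_le_sum h1).trans ?_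
  rw [Finset.sum_add_distrib, ← Finset.mul_sum, ← Finset.mul_sum]
  have h2 := sum_level x L
  have h3 : ∑ t ∈ Finset.range L, (1 / 4 : ℝ) ^ t ≤ 2 := by
    rw [geom_sum_eq (by norm_num)]
    have : (0 : ℝ) ≤ (1 / 4) ^ L := by positivity
    norm_num
    linarith
  nlinarith [(Nat.cast_nonneg n : (0 : ℝ) ≤ n)]

end DyadicLevels

/-! ### Deterministic bound on the heavy part -/

section Heavy

variable {n : ℕ} {ι : Type*} [Fintype ι] {f g : ι → Fin n} {u : ι → ℝ}

/-- For very unbalanced entries xy ≤ x² / 2 ^ ρ, so row sums of order 4 ^ ρ suffice and no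
discrepancy is needed. -/
lemma sum_mul_le_of_degree_le (hu : ∀ e, 0 ≤ u e) (x y : Fin n → ℕ)
    (hx : ∑ i, (x i : ℝ) ^ 2 ≤ 16 * n) {ρ : ℕ} {C : ℝ} (hC : 0 ≤ C)
    (hdeg : ∀ i, ∑ e with f e = i, u e ≤ C * 4 ^ ρ) :
    ∑ e with y (g e) * 2 ^ ρ ≤ x (f e), u e * x (f e) * y (g e) ≤ 16 * C * (n * 2 ^ ρ) := by
  have h1 : ∀ e ∈ Finset.univ.filter (fun e => y (g e) * 2 ^ ρ ≤ x (f e)),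
      u e * x (f e) * y (g e) ≤ u e * x (f e) ^ 2 / 2 ^ ρ := by
    intro e he
    have : (y (g e) : ℝ) * 2 ^ ρ ≤ x (f e) := by exact_mod_cast (Finset.mem_filter.1 he).2
    rw [le_div_iff₀ (by positivity)]
    calc u e * x (f e) * y (g e) * 2 ^ ρ = u e * x (f e) * (y (g e) * 2 ^ ρ) := by ring
      _ ≤ u e * x (f e) * x (f e) := by
        have := hu e
        gcongr
      _ = _ := by ring
  refine (Finset.sum_le_sum h1).trans ?_
  calc _ ≤ ∑ e, u e * (x (f e) : ℝ) ^ 2 / 2 ^ ρ :=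
        Finset.sum_le_sum_of_subset_of_nonneg (Finset.subset_univ _) fun e _ _ => by
          have := hu e
          positivity
    _ = ∑ i, ∑ e with f e = i, u e * (x (f e) : ℝ) ^ 2 / 2 ^ ρ :=
        (Finset.sum_fiberwise_of_maps_to (fun _ _ => Finset.mem_univ _) _).symm
    _ = ∑ i, (∑ e with f e = i, u e) * ((x i : ℝ) ^ 2 / 2 ^ ρ) := by
        refine Finset.sum_congr rfl fun i _ => ?_
        rw [Finset.sum_mul]
        refine Finset.sum_congr rfl fun e he => ?_
        rw [(Finset.mem_filter.1 he).2]; ring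
    _ ≤ ∑ i, C * 4 ^ ρ * ((x i : ℝ) ^ 2 / 2 ^ ρ) := by
        gcongr with i
        exact hdeg i
    _ = C * 2 ^ ρ * ∑ i, (x i : ℝ) ^ 2 := by
        rw [Finset.mul_sum]
        refine Finset.sum_congr rfl fun i _ => ?_
        rw [show (4 : ℝ) = 2 * 2 by norm_num, mul_pow]; field_simp
    _ ≤ C * 2 ^ ρ * (16 * n) := by gcongr
    _ = _ := by ring

/-- The exponent m = s + t + 2 - ρ is chosen so that 2 ^ (s + t) 4 ^ ρ 2 ^ m = 4 · 2 ^ ρ 4 ^ s 4 ^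
t: the main term becomes a product of squared level masses. As m ≥ 1, dividing by m can be forgone
in that term; it is kept for the costs. -/
lemma four_mul_two_pow_mul_le {ρ s t : ℕ} (h : ρ ≤ s + t + 1) {N a b c₁ c₂ K w : ℝ}
    (hA : 0 ≤ a * b * (4 ^ ρ / N))
    (hw : ((s + t + 2 - ρ : ℕ) : ℝ) * w ≤
      2 * (a * b * (4 ^ ρ / N) * 2 ^ (s + t + 2 - ρ) + K * (c₁ + c₂))) :
    4 * 2 ^ (s + t) * w ≤ 32 * (2 ^ ρ / N) * ((4 ^ s * a) * (4 ^ t * b)) +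
      8 * K * (2 ^ (s + t) * c₁ / ((s + t + 2 - ρ : ℕ) : ℝ) +
        2 ^ (s + t) * c₂ / ((s + t + 2 - ρ : ℕ) : ℝ)) := by
  obtain ⟨m, hm⟩ : ∃ m, s + t + 2 - ρ = m := ⟨_, rfl⟩
  have hm1 : (1 : ℝ) ≤ m := by
    have : 1 ≤ m := by omega
    exact_mod_cast this
  have hm0 : (0 : ℝ) < m := by linarith
  have hpow : (2 : ℝ) ^ (s + t) * 4 ^ ρ * 2 ^ m = 4 * 2 ^ ρ * (4 ^ s * 4 ^ t) := by
    have e1 : s + t + 2 * ρ + m = 2 + ρ + (2 * s + 2 * t) := by omega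
    have := congrArg (fun k => (2 : ℝ) ^ k) e1
    simp only [pow_add, pow_mul] at this ⊢
    norm_num at this ⊢
    linarith
  rw [hm] at hw ⊢
  have hA' : 0 ≤ a * b * (4 ^ ρ / N) * 2 ^ m := by positivity
  have hw2 : w ≤ 2 * (a * b * (4 ^ ρ / N) * 2 ^ m) + 2 * (K * (c₁ + c₂)) / m := by
    rw [← sub_le_iff_le_add', le_div_iff₀ hm0]
    nlinarith
  refine (mul_le_mul_of_nonneg_left hw2 (by positivity)).trans (le_of_eq ?_)
  have e1 : 4 * (2 : ℝ) ^ (s + t) * (2 * (a * b * (4 ^ ρ / N) * 2 ^ m)) =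
      8 * (a * b) / N * (2 ^ (s + t) * 4 ^ ρ * 2 ^ m) := by ring
  rw [mul_add, e1, hpow]
  ring

/-- Group the entries by the levels of x and y and apply the discrepancy property to each pair of
level sets. The main terms sum to 32 · 16² = 8192, the costs to 8 · 4 · 66 = 2112 times K, in units
of n · 2 ^ ρ. -/
lemma sum_balanced_le (hu : ∀ e, 0 ≤ u e) (x y : Fin n → ℕ)
    (hx : ∑ i, (x i : ℝ) ^ 2 ≤ 16 * n) (hy : ∑ i, (y i : ℝ) ^ 2 ≤ 16 * n) {ρ L : ℕ}
    (hxL : ∀ i, x i < 2 ^ L) (hyL : ∀ i, y i < 2 ^ L) {K : ℝ} (hK : 0 ≤ K)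
    (hcut : ∀ s < L, ∀ t < L, ρ ≤ s + t + 1 → ∀ S T : Finset (Fin n), S.Nonempty → T.Nonempty →
      ((s + t + 2 - ρ : ℕ) : ℝ) * cut f g u S T ≤
        2 * (S.card * T.card * (4 ^ ρ / n) * 2 ^ (s + t + 2 - ρ) +
          K * (levelCost s S + levelCost t T))) :
    ∑ e with 2 ^ ρ < x (f e) * y (g e) ∧ x (f e) < y (g e) * 2 ^ ρ ∧ y (g e) < x (f e) * 2 ^ ρ,
      u e * x (f e) * y (g e) ≤ (8192 + 2112 * K) * (n * 2 ^ ρ) := by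
  classical
  rcases Nat.eq_zero_or_pos n with hn0 | hn
  · subst hn0
    have : IsEmpty ι := ⟨fun e => (f e).elim0⟩
    simp
  have hn' : (0 : ℝ) < n := by exact_mod_cast hn
  have hdiv : ∀ R : ℝ, R / n * ((16 * n) * (16 * n)) = 256 * (n * R) := fun R => by
    field_simp; norm_num
  set E := Finset.univ.filter (fun e => 2 ^ ρ < x (f e) * y (g e) ∧
    x (f e) < y (g e) * 2 ^ ρ ∧ y (g e) < x (f e) * 2 ^ ρ) with hE
  set lev : ι → ℕ × ℕ := fun e => (Nat.log 2 (x (f e)), Nat.log 2 (y (g e))) with hlev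
  have hpos : ∀ e ∈ E, x (f e) ≠ 0 ∧ y (g e) ≠ 0 := by
    intro e he
    have := (Finset.mem_filter.1 he).2.1
    constructor <;> rintro h0 <;> simp [h0] at this
  have hup : ∀ k : ℕ, k < 2 ^ (Nat.log 2 k + 1) := fun k => Nat.lt_pow_succ_log_self (by norm_num) k
  -- Strict inequalities between powers of 2 recover the unit lost to each rounded logarithm. The
  -- last one gives ρ ≤ s + t + 1, so the subtraction s + t + 2 - ρ is not truncated.
  have hmaps : ∀ e ∈ E, lev e ∈ heavyPairs ρ L := by
    intro e he
    obtain ⟨hx0, hy0⟩ := hpos e he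
    obtain ⟨h1, h2, h3⟩ := (Finset.mem_filter.1 he).2
    have hlx := Nat.pow_log_le_self 2 hx0
    have hly := Nat.pow_log_le_self 2 hy0
    have hux := hup (x (f e))
    have huy := hup (y (g e))
    rw [mem_heavyPairs]
    simp only [hlev]
    refine ⟨⟨Nat.log_lt_of_lt_pow hx0 (hxL _), Nat.log_lt_of_lt_pow hy0 (hyL _)⟩, ?_, ?_, ?_⟩
    · have : 2 ^ Nat.log 2 (x (f e)) < 2 ^ (Nat.log 2 (y (g e)) + 1 + ρ) := by
        calc _ ≤ _ := hlx
          _ < _ := h2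
          _ ≤ _ := by rw [pow_add]; gcongr
      have := (Nat.pow_lt_pow_iff_right (by norm_num)).1 this
      omega
    · have : 2 ^ Nat.log 2 (y (g e)) < 2 ^ (Nat.log 2 (x (f e)) + 1 + ρ) := by
        calc _ ≤ _ := hly
          _ < _ := h3
          _ ≤ _ := by rw [pow_add]; gcongr
      have := (Nat.pow_lt_pow_iff_right (by norm_num)).1 this
      omega
    · have : 2 ^ ρ < 2 ^ (Nat.log 2 (x (f e)) + 1 + (Nat.log 2 (y (g e)) + 1)) := by
        calc _ < _ := h1
          _ ≤ _ := by rw [pow_add _ (Nat.log 2 (x (f e)) + 1)]; gcongr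
      have := (Nat.pow_lt_pow_iff_right (by norm_num)).1 this
      omega
  have hterm : ∀ p ∈ heavyPairs ρ L, ∑ e ∈ E with lev e = p, u e * x (f e) * y (g e) ≤
      32 * (2 ^ ρ / n) * ((4 ^ p.1 * (level x p.1).card) * (4 ^ p.2 * (level y p.2).card)) +
      8 * K * (2 ^ (p.1 + p.2) * levelCost p.1 (level x p.1) / ((p.1 + p.2 + 2 - ρ : ℕ) : ℝ) +
        2 ^ (p.1 + p.2) * levelCost p.2 (level y p.2) / ((p.1 + p.2 + 2 - ρ : ℕ) : ℝ)) := by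
    rintro ⟨s, t⟩ hp
    obtain ⟨⟨hs, ht⟩, ha, hb, hc⟩ := mem_heavyPairs.1 hp
    simp only at hs ht ha hb hc ⊢
    have hc1 := levelCost_nonneg s (level x s)
    have hc2 := levelCost_nonneg t (level y t)
    have hmem : ∀ e ∈ E.filter (fun e => lev e = (s, t)), f e ∈ level x s ∧ g e ∈ level y t := by
      intro e he
      obtain ⟨he1, he2⟩ := Finset.mem_filter.1 he
      simp only [hlev, Prod.mk.injEq] at he2
      simp only [level, Finset.mem_filter, Finset.mem_univ, true_and]
      exact ⟨⟨(hpos e he1).1, he2.1⟩, ⟨(hpos e he1).2, he2.2⟩⟩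
    rcases (E.filter (fun e => lev e = (s, t))).eq_empty_or_nonempty with h0 | ⟨e0, he0⟩
    · rw [h0, Finset.sum_empty]
      positivity
    have hS : (level x s).Nonempty := ⟨_, (hmem e0 he0).1⟩
    have hT : (level y t).Nonempty := ⟨_, (hmem e0 he0).2⟩
    have hle : ∑ e ∈ E with lev e = (s, t), u e * x (f e) * y (g e) ≤
        4 * 2 ^ (s + t) * cut f g u (level x s) (level y t) := by
      calc _ ≤ ∑ e ∈ E with lev e = (s, t), 4 * 2 ^ (s + t) * u e := by
            refine Finset.sum_le_sum fun e he => ?_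
            obtain ⟨he1, he2⟩ := Finset.mem_filter.1 he
            simp only [hlev, Prod.mk.injEq] at he2
            have h1 : (x (f e) : ℝ) ≤ 2 ^ (s + 1) := by
              have := (hup (x (f e))).le
              rw [he2.1] at this
              exact_mod_cast this
            have h2 : (y (g e) : ℝ) ≤ 2 ^ (t + 1) := by
              have := (hup (y (g e))).le
              rw [he2.2] at this
              exact_mod_cast this
            have := hu e
            calc u e * x (f e) * y (g e) ≤ u e * 2 ^ (s + 1) * 2 ^ (t + 1) := by gcongr
              _ = _ := by ring
        _ = 4 * 2 ^ (s + t) * ∑ e ∈ E with lev e = (s, t), u e := by rw [Finset.mul_sum]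
        _ ≤ _ := by
            refine mul_le_mul_of_nonneg_left ?_ (by positivity)
            refine Finset.sum_le_sum_of_subset_of_nonneg (fun e he => ?_) fun e _ _ => hu e
            simpa using hmem e he
    have hcut' := hcut s hs t ht hc _ _ hS hT
    exact hle.trans (four_mul_two_pow_mul_le hc (by positivity) hcut')
  rw [← Finset.sum_fiberwise_of_maps_to hmaps]
  refine (Finset.sum_le_sum hterm).trans ?_
  rw [Finset.sum_add_distrib, ← Finset.mul_sum, ← Finset.mul_sum, Finset.sum_add_distrib]
  have h1 : ∑ p ∈ heavyPairs ρ L,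
      ((4 : ℝ) ^ p.1 * (level x p.1).card) * (4 ^ p.2 * (level y p.2).card) ≤
      (16 * n) * (16 * n) := by
    calc _ ≤ ∑ p ∈ Finset.range L ×ˢ Finset.range L,
          ((4 : ℝ) ^ p.1 * (level x p.1).card) * (4 ^ p.2 * (level y p.2).card) :=
          Finset.sum_le_sum_of_subset_of_nonneg (Finset.filter_subset _ _)
            fun _ _ _ => by positivity
      _ = (∑ s ∈ Finset.range L, (4 : ℝ) ^ s * (level x s).card) *
          ∑ t ∈ Finset.range L, (4 : ℝ) ^ t * (level y t).card := by
          rw [Finset.sum_mul_sum, Finset.sum_product]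
      _ ≤ (16 * n) * (16 * n) :=
          mul_le_mul ((sum_level x L).trans hx) ((sum_level y L).trans hy)
            (Finset.sum_nonneg fun _ _ => by positivity) (by positivity)
  have h2 := (sum_heavyPairs_fst_le ρ L (fun s => levelCost s (level x s))
    fun _ => levelCost_nonneg _ _).trans
      (mul_le_mul_of_nonneg_left (sum_levelCost_le x hx L) (by positivity))
  have h3 := (sum_heavyPairs_snd_le ρ L (fun s => levelCost s (level y s))
    fun _ => levelCost_nonneg _ _).trans
      (mul_le_mul_of_nonneg_left (sum_levelCost_le y hy L) (by positivity))
  calc _ ≤ 32 * (2 ^ ρ / n) * ((16 * n) * (16 * n)) +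
        8 * K * (2 * 2 ^ ρ * (66 * n) + 2 * 2 ^ ρ * (66 * n)) :=
        add_le_add (mul_le_mul_of_nonneg_left h1 (by positivity))
          (mul_le_mul_of_nonneg_left (add_le_add h2 h3) (by positivity))
    _ = 32 * (2 ^ ρ / n * ((16 * n) * (16 * n))) + 2112 * K * (n * 2 ^ ρ) := by ring
    _ = _ := by
      rw [hdiv]
      ring

/-- The deterministic bound on the heavy part of a bilinear form, from bounded degrees and the
discrepancy property. -/
lemma sum_heavy_le (hu : ∀ e, 0 ≤ u e) (x y : Fin n → ℕ)
    (hx : ∑ i, (x i : ℝ) ^ 2 ≤ 16 * n) (hy : ∑ i, (y i : ℝ) ^ 2 ≤ 16 * n) {ρ L : ℕ}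
    (hxL : ∀ i, x i < 2 ^ L) (hyL : ∀ i, y i < 2 ^ L) {K : ℝ} (hK : 0 ≤ K)
    (hrow : ∀ i, ∑ e with f e = i, u e ≤ K * 4 ^ ρ)
    (hcol : ∀ i, ∑ e with g e = i, u e ≤ K * 4 ^ ρ)
    (hcut : ∀ s < L, ∀ t < L, ρ ≤ s + t + 1 → ∀ S T : Finset (Fin n), S.Nonempty → T.Nonempty →
      ((s + t + 2 - ρ : ℕ) : ℝ) * cut f g u S T ≤
        2 * (S.card * T.card * (4 ^ ρ / n) * 2 ^ (s + t + 2 - ρ) +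
          K * (levelCost s S + levelCost t T))) :
    ∑ e with 2 ^ ρ < x (f e) * y (g e), u e * x (f e) * y (g e) ≤
      (8192 + 2144 * K) * (n * 2 ^ ρ) := by
  have hnn : ∀ e, 0 ≤ u e * x (f e) * y (g e) := fun e => by
    have := hu e
    positivity
  have h1 := sum_mul_le_of_degree_le (f := f) (g := g) hu x y hx hK hrow
  have h2 := sum_mul_le_of_degree_le (f := g) (g := f) hu y x hy hK hcol
  have h3 := sum_balanced_le hu x y hx hy hxL hyL hK hcut
  have h4 : ∑ e with x (f e) * 2 ^ ρ ≤ y (g e), u e * x (f e) * y (g e) ≤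
      16 * K * (n * 2 ^ ρ) := by
    refine le_trans (le_of_eq (Finset.sum_congr rfl fun e _ => ?_)) h2
    ring
  rw [Finset.sum_filter] at h1 h3 h4 ⊢
  have : ∑ e, (if 2 ^ ρ < x (f e) * y (g e) then u e * x (f e) * y (g e) else 0) ≤
      ∑ e, (((if y (g e) * 2 ^ ρ ≤ x (f e) then u e * x (f e) * y (g e) else 0) +
        (if x (f e) * 2 ^ ρ ≤ y (g e) then u e * x (f e) * y (g e) else 0)) +
        (if 2 ^ ρ < x (f e) * y (g e) ∧ x (f e) < y (g e) * 2 ^ ρ ∧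
          y (g e) < x (f e) * 2 ^ ρ then u e * x (f e) * y (g e) else 0)) := by
    refine Finset.sum_le_sum fun e _ => ?_
    have := hnn e
    by_cases c1 : y (g e) * 2 ^ ρ ≤ x (f e)
    · rw [if_pos c1]
      split_ifs <;> linarith
    · by_cases c2 : x (f e) * 2 ^ ρ ≤ y (g e)
      · rw [if_pos c2]
        split_ifs <;> linarith
      · simp [c1, c2, not_le.1 c1, not_le.1 c2]
  rw [Finset.sum_add_distrib, Finset.sum_add_distrib] at this
  linarith

end Heavy

/-! ### One position pair: concentration and union bounds -/

section PairSample

variable {n : ℕ} {ι : Type*} [Fintype ι] {f g : ι → Fin n} {Ω : Type*} [MeasurableSpace Ω]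
  {P : Measure Ω} {W : ι → Ω → ℝ} {ρ : ℕ}

/-- Independent weights in `[0, 1]`, each attached to one entry `(f e, g e)` of an `n × n` matrix,
such that the expected total weight of an entry is at most `4 ^ ρ / n`. -/
structure IsPairSample (P : Measure Ω) (f g : ι → Fin n) (W : ι → Ω → ℝ) (ρ : ℕ) : Prop where
  measurable : ∀ e, Measurable (W e)
  mem_Icc : ∀ e, ∀ᵐ ω ∂P, W e ω ∈ Set.Icc (0 : ℝ) 1
  indep : iIndepFun W P
  mean_le : ∀ i j, ∑ e with f e = i ∧ g e = j, ∫ ω, W e ω ∂P ≤ 4 ^ ρ / n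

/-- The matrix with the entries `∑ u e`, summed over the `e` attached to the entry. -/
def entryMatrix (f g : ι → Fin n) (u : ι → ℝ) : Matrix (Fin n) (Fin n) ℝ :=
  Matrix.of fun i j => ∑ e with f e = i ∧ g e = j, u e

/-- The coefficient of the entry `e` in the light part of the bilinear form. -/
def lightCoeff (f g : ι → Fin n) (ρ : ℕ) (z w : Fin n → ℤ) (e : ι) : ℝ :=
  if (z (f e)).natAbs * (w (g e)).natAbs ≤ 2 ^ ρ then (z (f e) : ℝ) * w (g e) else 0

lemma natCast_natAbs_mul_natAbs (a b : ℤ) :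
    ((a.natAbs * b.natAbs : ℕ) : ℝ) = |(a : ℝ) * b| := by
  rw [← Int.natAbs_mul, Nat.cast_natAbs, Int.cast_abs, Int.cast_mul]

lemma sum_sum_entryMatrix_mul (u : ι → ℝ) (φ : Fin n → Fin n → ℝ) :
    ∑ i, ∑ j, entryMatrix f g u i j * φ i j = ∑ e, u e * φ (f e) (g e) := by
  have h := Finset.sum_fiberwise_of_maps_to (s := (Finset.univ : Finset ι))
    (t := (Finset.univ : Finset (Fin n × Fin n))) (g := fun e => (f e, g e))
    (fun _ _ => Finset.mem_univ _) (fun e => u e * φ (f e) (g e))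
  rw [← h, Fintype.sum_prod_type]
  refine Finset.sum_congr rfl fun i _ => Finset.sum_congr rfl fun j _ => ?_
  rw [entryMatrix, Matrix.of_apply, Finset.sum_mul]
  refine Finset.sum_congr (by ext; simp [Prod.ext_iff]) fun e he => ?_
  simp only [Finset.mem_filter, Finset.mem_univ, true_and, Prod.mk.injEq] at he
  rw [he.1, he.2]

lemma exp_neg_le_inv_pow {r : ℕ} (hn : 0 < n) {x : ℝ} (hx : Real.log n ≤ x) :
    Real.exp (-(r * x)) ≤ ((n : ℝ) ^ r)⁻¹ := by
  have hn' : (0 : ℝ) < n := by exact_mod_cast hn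
  rw [← Real.exp_log (inv_pos.2 (pow_pos hn' r)), Real.log_inv, Real.log_pow, Real.exp_le_exp,
    neg_le_neg_iff]
  gcongr

namespace IsPairSample

lemma mean_nonneg (h : IsPairSample P f g W ρ) (e : ι) : 0 ≤ ∫ ω, W e ω ∂P :=
  integral_nonneg_of_ae ((h.mem_Icc e).mono fun _ hω => hω.1)

lemma swap (h : IsPairSample P f g W ρ) : IsPairSample P g f W ρ where
  measurable := h.measurable
  mem_Icc := h.mem_Icc
  indep := h.indep
  mean_le i j := by simpa only [and_comm] using h.mean_le j i

lemma sum_mean_mul_le (h : IsPairSample P f g W ρ) (φ : Fin n → Fin n → ℝ)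
    (hφ : ∀ i j, 0 ≤ φ i j) :
    ∑ e, (∫ ω, W e ω ∂P) * φ (f e) (g e) ≤ 4 ^ ρ / n * ∑ i, ∑ j, φ i j := by
  rw [← sum_sum_entryMatrix_mul, Finset.mul_sum]
  refine Finset.sum_le_sum fun i _ => ?_
  rw [Finset.mul_sum]
  refine Finset.sum_le_sum fun j _ => ?_
  exact mul_le_mul_of_nonneg_right (h.mean_le i j) (hφ i j)

/-- This second-moment bound serves twice: as the variance proxy for light entries and to control
the mean on heavy ones. -/
lemma sum_mean_mul_sq_le (h : IsPairSample P f g W ρ) (hn : 0 < n) {z w : Fin n → ℤ}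
    (hz : z ∈ latticeBall n) (hw : w ∈ latticeBall n) :
    ∑ e, (∫ ω, W e ω ∂P) * ((z (f e) : ℝ) ^ 2 * (w (g e) : ℝ) ^ 2) ≤ 256 * n * 4 ^ ρ := by
  have hn' : (0 : ℝ) < n := by exact_mod_cast hn
  have hz' : ∑ i, (z i : ℝ) ^ 2 ≤ 16 * n := by exact_mod_cast mem_latticeBall.1 hz
  have hw' : ∑ i, (w i : ℝ) ^ 2 ≤ 16 * n := by exact_mod_cast mem_latticeBall.1 hw
  refine (h.sum_mean_mul_le (fun i j => (z i : ℝ) ^ 2 * (w j : ℝ) ^ 2)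
    fun _ _ => by positivity).trans ?_
  rw [← Finset.sum_mul_sum]
  calc _ ≤ 4 ^ ρ / (n : ℝ) * (16 * n * (16 * n)) :=
        mul_le_mul_of_nonneg_left (mul_le_mul hz' hw' (Finset.sum_nonneg fun _ _ => sq_nonneg _)
          (by positivity)) (by positivity)
    _ = 256 * n * 4 ^ ρ := by
        generalize (4 : ℝ) ^ ρ = D
        field_simp
        norm_num

lemma spectralNorm_le_of_good (h : IsPairSample P f g W ρ) (hn : 0 < n) (r : ℕ) {u : ι → ℝ}
    (hu : ∀ e, 0 ≤ u e)
    (hlight : ∀ z ∈ latticeBall n, ∀ w ∈ latticeBall n,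
      ∑ e, lightCoeff f g ρ z w e * (u e - ∫ ω', W e ω' ∂P) ≤ (292 + r) * (n * 2 ^ ρ))
    (hrow : ∀ i, ∑ e with f e = i, u e ≤ (r + 3) * 4 ^ ρ)
    (hcol : ∀ i, ∑ e with g e = i, u e ≤ (r + 3) * 4 ^ ρ)
    (hcut : ∀ s < n + 4, ∀ t < n + 4, ∀ S T : Finset (Fin n), S.Nonempty → T.Nonempty →
      ((s + t + 2 - ρ : ℕ) : ℝ) * Real.log 2 * cut f g u S T ≤
        S.card * T.card * (4 ^ ρ / n) * 2 ^ (s + t + 2 - ρ) +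
          (r + 3) * (levelCost s S + levelCost t T)) :
    spectralNorm (entryMatrix f g fun e => u e - ∫ ω, W e ω ∂P) ≤ 640 * (r + 3) * 2 ^ ρ := by
  set m : ι → ℝ := fun e => ∫ ω, W e ω ∂P with hm
  set R : ℝ := 2 ^ ρ with hR
  have hR0 : 0 < R := by positivity
  have hn' : (0 : ℝ) < n := by exact_mod_cast hn
  have key : spectralNorm (entryMatrix f g fun e => u e - m e) ≤ 5120 * (r + 3) * R / 8 := by
    refine spectralNorm_le_of_lattice hn _ fun z w hz hw => ?_
    have hzb := mem_latticeBall.2 hz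
    have hwb := mem_latticeBall.2 hw
    have hz' : ∑ i, ((z i).natAbs : ℝ) ^ 2 ≤ 16 * n := by
      simp only [Nat.cast_natAbs, Int.cast_abs, sq_abs]
      exact_mod_cast hz
    have hw' : ∑ i, ((w i).natAbs : ℝ) ^ 2 ≤ 16 * n := by
      simp only [Nat.cast_natAbs, Int.cast_abs, sq_abs]
      exact_mod_cast hw
    -- Since |v_i| ≤ v_i² ≤ 16n < 2 ^ (n + 4), n + 4 levels are enough; this crude count costs only
    -- (n + 4)² in the union bound.
    have hL : ∀ v : Fin n → ℤ, ∑ i, v i ^ 2 ≤ 16 * n → ∀ i, (v i).natAbs < 2 ^ (n + 4) := by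
      intro v hv i
      have h1 : v i ^ 2 ≤ 16 * n :=
        (Finset.single_le_sum (f := fun i => v i ^ 2) (fun i _ => sq_nonneg _)
          (Finset.mem_univ i)).trans hv
      have h2 : (v i).natAbs ≤ (v i).natAbs ^ 2 := Nat.le_self_pow (by norm_num) _
      have h3 : ((v i).natAbs : ℤ) ^ 2 = v i ^ 2 := Int.natAbs_sq _
      have h4 : (v i).natAbs ^ 2 ≤ 16 * n := by exact_mod_cast h3.le.trans h1
      have h5 : n < 2 ^ n := Nat.lt_two_pow_self
      rw [pow_add]
      omega
    have hheavy := sum_heavy_le (f := f) (g := g) hu (fun i => (z i).natAbs)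
      (fun i => (w i).natAbs) hz' hw' (ρ := ρ) (L := n + 4) (hL z hz) (hL w hw)
      (K := r + 3) (by positivity) hrow hcol (fun s hs t ht _ S T hS hT => by
        have h1 := hcut s hs t ht S T hS hT
        have h2 : 0 ≤ cut f g u S T := Finset.sum_nonneg fun e _ => hu e
        have h3 : (1 / 2 : ℝ) ≤ Real.log 2 := by linarith [Real.log_two_gt_d9]
        have h4 : ((s + t + 2 - ρ : ℕ) : ℝ) * (1 / 2) * cut f g u S T ≤
            ((s + t + 2 - ρ : ℕ) : ℝ) * Real.log 2 * cut f g u S T := by gcongr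
        linarith)
    have hmean := h.sum_mean_mul_sq_le hn hzb hwb
    have hl := hlight z hzb w hwb
    have hsum : ∑ i, ∑ j, entryMatrix f g (fun e => u e - m e) i j * z i * w j =
        ∑ e, (u e - m e) * ((z (f e) : ℝ) * w (g e)) := by
      rw [← sum_sum_entryMatrix_mul (fun e => u e - m e) (fun i j => (z i : ℝ) * w j)]
      simp only [mul_assoc]
    rw [hsum]
    rw [Finset.sum_filter] at hheavy
    -- On a heavy entry the coefficient b has |b| > R, so the mean contributes at most m|b| ≤ m b² /
    -- R.
    have hterm : ∀ e, (u e - m e) * ((z (f e) : ℝ) * w (g e)) ≤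
        lightCoeff f g ρ z w e * (u e - m e) +
        (if 2 ^ ρ < (z (f e)).natAbs * (w (g e)).natAbs then
          u e * (z (f e)).natAbs * (w (g e)).natAbs else 0) +
        m e * ((z (f e) : ℝ) ^ 2 * (w (g e) : ℝ) ^ 2) / R := by
      intro e
      have hm0 : 0 ≤ m e := h.mean_nonneg e
      have hu0 := hu e
      rw [lightCoeff]
      by_cases hc : (z (f e)).natAbs * (w (g e)).natAbs ≤ 2 ^ ρ
      · rw [if_pos hc, if_neg (not_lt.2 hc)]
        have : 0 ≤ m e * ((z (f e) : ℝ) ^ 2 * (w (g e) : ℝ) ^ 2) / R := by positivity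
        linarith
      · rw [if_neg hc, if_pos (not_le.1 hc)]
        have h1 : R < |(z (f e) : ℝ) * w (g e)| := by
          rw [← natCast_natAbs_mul_natAbs, hR]
          exact_mod_cast not_le.1 hc
        rw [mul_assoc (u e), ← Nat.cast_mul, natCast_natAbs_mul_natAbs, ← mul_pow, ← sq_abs, zero_mul, zero_add]
        set b := (z (f e) : ℝ) * w (g e)
        have h2 : |b| ≤ |b| ^ 2 / R := by
          rw [le_div_iff₀ hR0, sq]
          gcongr
        have h3 : u e * b ≤ u e * |b| := mul_le_mul_of_nonneg_left (le_abs_self b) hu0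
        have h4 : m e * (-b) ≤ m e * (|b| ^ 2 / R) :=
          mul_le_mul_of_nonneg_left ((neg_le_abs b).trans h2) hm0
        rw [mul_div_assoc]
        linarith
    refine (Finset.sum_le_sum fun e _ => hterm e).trans ?_
    rw [Finset.sum_add_distrib, Finset.sum_add_distrib, ← Finset.sum_div]
    have hR2 : (4 : ℝ) ^ ρ = R * R := by rw [hR, ← mul_pow]; norm_num
    have hmean' : (∑ e, m e * ((z (f e) : ℝ) ^ 2 * (w (g e) : ℝ) ^ 2)) / R ≤ 256 * (n * R) := by
      rw [div_le_iff₀ hR0]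
      rw [hR2] at hmean
      linarith
    have hp : 0 ≤ (n : ℝ) * R := by positivity
    have hr : (0 : ℝ) ≤ r := r.cast_nonneg
    nlinarith [mul_nonneg hr hp]
  linarith

variable [IsProbabilityMeasure P]

/-- Divided by 2 ^ ρ, light coefficients satisfy |a| ≤ 1, where exp a - 1 - a ≤ a². The quadratic
terms total at most 256n, and 292 = 256 + 36 leaves exp(-36n) to pay for two lattice vectors. -/
lemma measureReal_light_le (h : IsPairSample P f g W ρ) (hn : 0 < n) (r : ℕ) {z w : Fin n → ℤ}
    (hz : z ∈ latticeBall n) (hw : w ∈ latticeBall n) :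
    P.real {ω | (292 + r) * (n * 2 ^ ρ) ≤
      ∑ e, lightCoeff f g ρ z w e * (W e ω - ∫ ω', W e ω' ∂P)} ≤ Real.exp (-((36 + r) * n)) := by
  set R : ℝ := 2 ^ ρ with hR
  have hR0 : 0 < R := by positivity
  have hR2 : R ^ 2 = 4 ^ ρ := by rw [hR, ← pow_mul, mul_comm, pow_mul]; norm_num
  set m : ι → ℝ := fun e => ∫ ω, W e ω ∂P with hm
  set a : ι → ℝ := fun e => lightCoeff f g ρ z w e / R with ha
  have hset : {ω | (292 + r) * (n * R) ≤
      ∑ e, lightCoeff f g ρ z w e * (W e ω - m e)} =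
      {ω | (292 + r) * n + ∑ e, m e * a e ≤ ∑ e, a e * W e ω} := by
    ext ω
    have e1 : ∑ e, lightCoeff f g ρ z w e * (W e ω - m e) =
        R * (∑ e, a e * W e ω - ∑ e, m e * a e) := by
      rw [← Finset.sum_sub_distrib, Finset.mul_sum]
      refine Finset.sum_congr rfl fun e _ => ?_
      simp only [ha]
      field_simp
    rw [Set.mem_ofPred_eq, Set.mem_ofPred_eq, e1, ← le_sub_iff_add_le, mul_comm R,
      ← mul_assoc, mul_le_mul_iff_left₀ hR0]
  have hone : ∀ e, |a e| ≤ 1 := by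
    intro e
    simp only [ha, lightCoeff]
    split_ifs with hc
    · rw [abs_div, abs_of_pos hR0, div_le_one hR0, ← natCast_natAbs_mul_natAbs, hR]
      exact_mod_cast hc
    · simp
  have hsq : ∀ e, a e ^ 2 ≤ (z (f e) : ℝ) ^ 2 * (w (g e) : ℝ) ^ 2 / R ^ 2 := by
    intro e
    simp only [ha, lightCoeff, div_pow]
    gcongr
    split_ifs
    · rw [mul_pow]
    · rw [zero_pow two_ne_zero]
      positivity
  have hexp : ∑ e, m e * (Real.exp (a e) - 1) ≤ ∑ e, m e * a e + 256 * n := by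
    have h1 : ∀ e, m e * (Real.exp (a e) - 1) ≤ m e * a e +
        m e * ((z (f e) : ℝ) ^ 2 * (w (g e) : ℝ) ^ 2) / R ^ 2 := by
      intro e
      have h2 := (abs_le.1 (Real.abs_exp_sub_one_sub_id_le (hone e))).2
      have h3 := hsq e
      have h4 : 0 ≤ m e := h.mean_nonneg e
      rw [mul_div_assoc, ← mul_add]
      exact mul_le_mul_of_nonneg_left (by linarith) h4
    refine (Finset.sum_le_sum fun e _ => h1 e).trans ?_
    rw [Finset.sum_add_distrib, ← Finset.sum_div]
    gcongr
    rw [div_le_iff₀ (by positivity), hR2]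
    exact h.sum_mean_mul_sq_le hn hz hw
  rw [hset]
  refine (measureReal_le_sum_mul_le_exp h.measurable h.mem_Icc h.indep a _).trans ?_
  rw [Real.exp_le_exp]
  linarith

lemma measureReal_exists_light_le (h : IsPairSample P f g W ρ) (hn : 0 < n) (r : ℕ) :
    P.real {ω | ∃ z ∈ latticeBall n, ∃ w ∈ latticeBall n, (292 + r) * (n * 2 ^ ρ) ≤
      ∑ e, lightCoeff f g ρ z w e * (W e ω - ∫ ω', W e ω' ∂P)} ≤ ((n : ℝ) ^ r)⁻¹ := by
  have hset : {ω | ∃ z ∈ latticeBall n, ∃ w ∈ latticeBall n, (292 + r) * (n * 2 ^ ρ) ≤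
      ∑ e, lightCoeff f g ρ z w e * (W e ω - ∫ ω', W e ω' ∂P)} =
      ⋃ p ∈ latticeBall n ×ˢ latticeBall n, {ω | (292 + r) * (n * 2 ^ ρ) ≤
        ∑ e, lightCoeff f g ρ p.1 p.2 e * (W e ω - ∫ ω', W e ω' ∂P)} := by
    ext ω
    simp only [Set.mem_ofPred_eq, Set.mem_iUnion, Finset.mem_product, exists_prop, Prod.exists]
    tauto
  rw [hset]
  refine (measureReal_biUnion_finset_le _ _).trans ?_
  calc _ ≤ ∑ p ∈ latticeBall n ×ˢ latticeBall n, Real.exp (-((36 + r) * n)) :=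
        Finset.sum_le_sum fun p hp =>
          h.measureReal_light_le hn r (Finset.mem_product.1 hp).1 (Finset.mem_product.1 hp).2
    _ = (latticeBall n).card * (latticeBall n).card * Real.exp (-((36 + r) * n)) := by
        rw [Finset.sum_const, Finset.card_product, nsmul_eq_mul, Nat.cast_mul]
    _ ≤ Real.exp (18 * n) * Real.exp (18 * n) * Real.exp (-((36 + r) * n)) := by
        have := card_latticeBall_le n
        gcongr
    _ = Real.exp (-(r * n)) := by
        rw [← Real.exp_add, ← Real.exp_add]; ring_nf
    _ ≤ _ := exp_neg_le_inv_pow hn (Real.log_le_self (by positivity))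

/-- A row has mean at most 4 ^ ρ and e - 1 ≤ 2, so Chernoff leaves exp(-(r + 1) 4 ^ ρ) ≤ n^(-(r +
1)); the union over rows uses up one factor n. Here 4 ^ ρ ≥ log n is essential. -/
lemma measureReal_exists_degree_le (h : IsPairSample P f g W ρ) (hn : 0 < n)
    (hlog : Real.log n ≤ 4 ^ ρ) (r : ℕ) :
    P.real {ω | ∃ i, (r + 3) * 4 ^ ρ ≤ ∑ e with f e = i, W e ω} ≤ ((n : ℝ) ^ r)⁻¹ := by
  have hn' : (0 : ℝ) < n := by exact_mod_cast hn
  have hone : ∀ i, P.real {ω | (r + 3) * 4 ^ ρ ≤ ∑ e with f e = i, W e ω} ≤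
      ((n : ℝ) ^ (r + 1))⁻¹ := by
    intro i
    have hc := measureReal_le_sum_mul_le_exp h.measurable h.mem_Icc h.indep
      (fun e => if f e = i then 1 else 0) ((r + 3) * 4 ^ ρ)
    have hset : ∀ ω, ∑ e, (if f e = i then (1 : ℝ) else 0) * W e ω = ∑ e with f e = i, W e ω := by
      intro ω
      rw [Finset.sum_filter]
      exact Finset.sum_congr rfl fun e _ => by split_ifs <;> simp
    simp only [hset] at hc
    refine hc.trans (le_trans ?_ (exp_neg_le_inv_pow hn hlog))
    rw [Real.exp_le_exp]
    have h1 := h.sum_mean_mul_le (fun k _ => if k = i then 2 else 0)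
      (fun _ _ => by split_ifs <;> norm_num)
    have h2 : ∑ k : Fin n, ∑ _j : Fin n, (if k = i then (2 : ℝ) else 0) = 2 * n := by
      simp [mul_comm]
    have h3 : 4 ^ ρ / (n : ℝ) * (2 * n) = 2 * 4 ^ ρ := by
      generalize (4 : ℝ) ^ ρ = D
      field_simp
    rw [h2, h3] at h1
    have h4 : ∑ e, (∫ ω, W e ω ∂P) * (Real.exp (if f e = i then 1 else 0) - 1) ≤
        ∑ e, (∫ ω, W e ω ∂P) * (if f e = i then 2 else 0) := by
      refine Finset.sum_le_sum fun e _ => mul_le_mul_of_nonneg_left ?_ (h.mean_nonneg e)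
      split_ifs
      · linarith [Real.exp_one_lt_d9]
      · simp
    push_cast
    linarith
  have hset : {ω | ∃ i, (r + 3) * 4 ^ ρ ≤ ∑ e with f e = i, W e ω} =
      ⋃ i ∈ (Finset.univ : Finset (Fin n)), {ω | (r + 3) * 4 ^ ρ ≤ ∑ e with f e = i, W e ω} := by
    ext ω
    simp
  rw [hset]
  refine (measureReal_biUnion_finset_le _ _).trans ((Finset.sum_le_sum fun i _ => hone i).trans ?_)
  rw [Finset.sum_const, Finset.card_univ, Fintype.card_fin, nsmul_eq_mul, pow_succ, mul_inv,
    mul_comm, mul_assoc, inv_mul_cancel₀ hn'.ne', mul_one]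

/-- Chernoff with coefficient m log 2 on the cut: exp(m log 2) - 1 ≤ 2 ^ m. Fixing the parameter in
advance gives a discrepancy inequality linear in the cut, with no optimisation over it. -/
lemma measureReal_cut_le (h : IsPairSample P f g W ρ) (m : ℕ) (S T : Finset (Fin n)) (c : ℝ) :
    P.real {ω | S.card * T.card * (4 ^ ρ / n) * 2 ^ m + c ≤
      m * Real.log 2 * cut f g (fun e => W e ω) S T} ≤ Real.exp (-c) := by
  have hc := measureReal_le_sum_mul_le_exp h.measurable h.mem_Icc h.indep
    (fun e => if f e ∈ S ∧ g e ∈ T then m * Real.log 2 else 0)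
    (S.card * T.card * (4 ^ ρ / n) * 2 ^ m + c)
  have hset : ∀ ω, ∑ e, (if f e ∈ S ∧ g e ∈ T then m * Real.log 2 else 0) * W e ω =
      m * Real.log 2 * cut f g (fun e => W e ω) S T := by
    intro ω
    rw [cut, Finset.sum_filter, Finset.mul_sum]
    exact Finset.sum_congr rfl fun e _ => by split_ifs <;> simp
  simp only [hset] at hc
  refine hc.trans ?_
  rw [Real.exp_le_exp]
  have h1 := h.sum_mean_mul_le (fun i j => if i ∈ S ∧ j ∈ T then 2 ^ m else 0)
    (fun _ _ => by split_ifs <;> positivity)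
  have h2 : ∑ i : Fin n, ∑ j : Fin n, (if i ∈ S ∧ j ∈ T then (2 : ℝ) ^ m else 0) =
      S.card * T.card * 2 ^ m := by
    simp only [ite_and]
    simp [Finset.sum_ite_mem, mul_assoc]
  rw [h2] at h1
  have h4 : ∑ e, (∫ ω, W e ω ∂P) *
      (Real.exp (if f e ∈ S ∧ g e ∈ T then m * Real.log 2 else 0) - 1) ≤
      ∑ e, (∫ ω, W e ω ∂P) * (if f e ∈ S ∧ g e ∈ T then 2 ^ m else 0) := by
    refine Finset.sum_le_sum fun e _ => mul_le_mul_of_nonneg_left ?_ (h.mean_nonneg e)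
    split_ifs
    · rw [Real.exp_nat_mul, Real.exp_log two_pos]; linarith
    · simp
  linarith

lemma measureReal_exists_cut_le (h : IsPairSample P f g W ρ) (hn : 2 ≤ n) (r : ℕ) :
    P.real {ω | ∃ s < n + 4, ∃ t < n + 4, ∃ S T : Finset (Fin n), S.Nonempty ∧ T.Nonempty ∧
      S.card * T.card * (4 ^ ρ / n) * 2 ^ (s + t + 2 - ρ) +
        (r + 3) * (levelCost s S + levelCost t T) ≤
      ((s + t + 2 - ρ : ℕ) : ℝ) * Real.log 2 * cut f g (fun e => W e ω) S T} ≤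
      9 * ((n : ℝ) ^ r)⁻¹ := by
  classical
  have hn0 : 0 < n := by omega
  have hn' : (0 : ℝ) < n := by exact_mod_cast hn0
  set I := Finset.range (n + 4) ×ˢ Finset.range (n + 4)
  set J := Finset.univ.filter fun q : Finset (Fin n) × Finset (Fin n) =>
    q.1.Nonempty ∧ q.2.Nonempty
  set B : (ℕ × ℕ) → Finset (Fin n) × Finset (Fin n) → Set Ω := fun p q =>
    {ω | q.1.card * q.2.card * (4 ^ ρ / n) * 2 ^ (p.1 + p.2 + 2 - ρ) +
        (r + 3) * (levelCost p.1 q.1 + levelCost p.2 q.2) ≤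
      ((p.1 + p.2 + 2 - ρ : ℕ) : ℝ) * Real.log 2 * cut f g (fun e => W e ω) q.1 q.2} with hB
  refine (measureReal_mono (s₂ := ⋃ p ∈ I, ⋃ q ∈ J, B p q) ?_ (measure_ne_top P _)).trans ?_
  · rintro ω ⟨s, hs, t, ht, S, T, hS, hT, hω⟩
    simp only [Set.mem_iUnion]
    exact ⟨(s, t), by simp [I, hs, ht], (S, T), by simp [J, hS, hT], hω⟩
  -- Of the r + 3 copies of each cost, r + 2 become powers of n by nonemptiness; the last makes the
  -- sum over all sets at most 1.
  have hBle : ∀ p, ∀ q ∈ J, P.real (B p q) ≤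
      ((n : ℝ) ^ (2 * (r + 2)))⁻¹ * (Real.exp (-levelCost p.1 q.1) * Real.exp (-levelCost p.2 q.2)) := by
    intro p q hq
    obtain ⟨hS, hT⟩ := (Finset.mem_filter.1 hq).2
    refine (h.measureReal_cut_le _ _ _ _).trans ?_
    have h1 := exp_neg_le_inv_pow (r := r + 2) hn0 (log_le_levelCost p.1 hS)
    have h2 := exp_neg_le_inv_pow (r := r + 2) hn0 (log_le_levelCost p.2 hT)
    calc Real.exp (-((r + 3) * (levelCost p.1 q.1 + levelCost p.2 q.2))) =
        Real.exp (-((r + 2 : ℕ) * levelCost p.1 q.1)) *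
          Real.exp (-((r + 2 : ℕ) * levelCost p.2 q.2)) *
          (Real.exp (-levelCost p.1 q.1) * Real.exp (-levelCost p.2 q.2)) := by
          rw [← Real.exp_add, ← Real.exp_add, ← Real.exp_add]; push_cast; ring_nf
      _ ≤ ((n : ℝ) ^ (r + 2))⁻¹ * ((n : ℝ) ^ (r + 2))⁻¹ *
          (Real.exp (-levelCost p.1 q.1) * Real.exp (-levelCost p.2 q.2)) := by gcongr
      _ = _ := by rw [← mul_inv, ← pow_add, ← two_mul]
  have hin : ∀ p, P.real (⋃ q ∈ J, B p q) ≤ ((n : ℝ) ^ (2 * (r + 2)))⁻¹ := by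
    intro p
    refine (measureReal_biUnion_finset_le _ _).trans
      ((Finset.sum_le_sum fun q hq => hBle p q hq).trans ?_)
    rw [← Finset.mul_sum]
    refine mul_le_of_le_one_right (by positivity) ?_
    calc _ ≤ ∑ q : Finset (Fin n) × Finset (Fin n),
          Real.exp (-levelCost p.1 q.1) * Real.exp (-levelCost p.2 q.2) :=
          Finset.sum_le_sum_of_subset_of_nonneg (Finset.subset_univ _)
            fun _ _ _ => by positivity
      _ = (∑ S : Finset (Fin n), Real.exp (-levelCost p.1 S)) *
          ∑ T : Finset (Fin n), Real.exp (-levelCost p.2 T) := by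
          rw [Finset.sum_mul_sum, Fintype.sum_prod_type]
      _ ≤ 1 := mul_le_one₀ (sum_exp_neg_levelCost_le n _)
          (Finset.sum_nonneg fun _ _ => Real.exp_nonneg _) (sum_exp_neg_levelCost_le n _)
  refine (measureReal_biUnion_finset_le _ _).trans ((Finset.sum_le_sum fun p _ => hin p).trans ?_)
  rw [Finset.sum_const, nsmul_eq_mul, Finset.card_product, Finset.card_range]
  have h1 : ((n + 4 : ℕ) : ℝ) ≤ 3 * n := by
    have : n + 4 ≤ 3 * n := by omega
    exact_mod_cast this
  have h2 : (n : ℝ) ^ 2 * ((n : ℝ) ^ (2 * (r + 2)))⁻¹ ≤ ((n : ℝ) ^ r)⁻¹ := by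
    rw [← div_eq_mul_inv, div_le_iff₀ (by positivity), ← div_eq_inv_mul,
      le_div_iff₀ (by positivity), ← pow_add]
    exact pow_le_pow_right₀ (by exact_mod_cast hn0) (by omega)
  calc _ ≤ (3 * n) * (3 * n) * ((n : ℝ) ^ (2 * (r + 2)))⁻¹ := by
        rw [Nat.cast_mul]; gcongr
    _ = 9 * ((n : ℝ) ^ 2 * ((n : ℝ) ^ (2 * (r + 2)))⁻¹) := by ring
    _ ≤ _ := by gcongr

lemma measureReal_spectralNorm_gt_le (h : IsPairSample P f g W ρ) (hn : 2 ≤ n)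
    (hlog : Real.log n ≤ 4 ^ ρ) (r : ℕ) :
    P.real {ω | ¬ spectralNorm (entryMatrix f g fun e => W e ω - ∫ ω', W e ω' ∂P) ≤
      640 * (r + 3) * 2 ^ ρ} ≤ 12 * ((n : ℝ) ^ r)⁻¹ := by
  have hn0 : 0 < n := by omega
  have h1 := h.measureReal_exists_light_le hn0 r
  have h2 := h.measureReal_exists_degree_le hn0 hlog r
  have h3 := h.swap.measureReal_exists_degree_le hn0 hlog r
  have h4 := h.measureReal_exists_cut_le hn r
  have h0 : P.real {ω | ¬ ∀ e, W e ω ∈ Set.Icc (0 : ℝ) 1} = 0 := by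
    rw [measureReal_def, ae_iff.1 (ae_all_iff.2 h.mem_Icc), ENNReal.toReal_zero]
  set B0 := {ω | ¬ ∀ e, W e ω ∈ Set.Icc (0 : ℝ) 1}
  set B1 := {ω | ∃ z ∈ latticeBall n, ∃ w ∈ latticeBall n, (292 + r) * (n * 2 ^ ρ) ≤
      ∑ e, lightCoeff f g ρ z w e * (W e ω - ∫ ω', W e ω' ∂P)}
  set B2 := {ω | ∃ i, (r + 3) * 4 ^ ρ ≤ ∑ e with f e = i, W e ω}
  set B3 := {ω | ∃ i, (r + 3) * 4 ^ ρ ≤ ∑ e with g e = i, W e ω}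
  set B4 := {ω | ∃ s < n + 4, ∃ t < n + 4, ∃ S T : Finset (Fin n), S.Nonempty ∧ T.Nonempty ∧
      S.card * T.card * (4 ^ ρ / n) * 2 ^ (s + t + 2 - ρ) +
        (r + 3) * (levelCost s S + levelCost t T) ≤
      ((s + t + 2 - ρ : ℕ) : ℝ) * Real.log 2 * cut f g (fun e => W e ω) S T}
  have hsub : {ω | ¬ spectralNorm (entryMatrix f g fun e => W e ω - ∫ ω', W e ω' ∂P) ≤
      640 * (r + 3) * 2 ^ ρ} ⊆ B0 ∪ (B1 ∪ (B2 ∪ (B3 ∪ B4))) := by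
    intro ω hω
    by_contra hb
    simp only [Set.mem_union, not_or] at hb
    obtain ⟨b0, b1, b2, b3, b4⟩ := hb
    simp only [B0, B1, B2, B3, B4, Set.mem_ofPred_eq, not_not, not_exists, not_and, not_le]
      at b0 b1 b2 b3 b4
    refine hω (h.spectralNorm_le_of_good hn0 r (fun e => (b0 e).1) (fun z hz w hw =>
      (b1 z hz w hw).le) (fun i => (b2 i).le) (fun i => (b3 i).le)
      fun s hs t ht S T hS hT => (b4 s hs t ht S T hS hT).le)
  have e0 := measureReal_union_le (μ := P) B0 (B1 ∪ (B2 ∪ (B3 ∪ B4)))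
  have e1 := measureReal_union_le (μ := P) B1 (B2 ∪ (B3 ∪ B4))
  have e2 := measureReal_union_le (μ := P) B2 (B3 ∪ B4)
  have e3 := measureReal_union_le (μ := P) B3 B4
  have := measureReal_mono (μ := P) hsub
  linarith

end IsPairSample

end PairSample

/-! ### Splitting the similarity matrix by vertex positions -/

section Hypergraph

variable {n d : ℕ}

/-- The `a`-th vertex of the edge `e`, in increasing order. -/
def vertex (a : Fin d) (e : Edge n d) : Fin n := e.1.orderEmbOfFin e.2 a

lemma vertex_injective (e : Edge n d) : Function.Injective fun a => vertex a e :=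
  (e.1.orderEmbOfFin e.2).injective

lemma vertex_mem (a : Fin d) (e : Edge n d) : vertex a e ∈ e.1 :=
  Finset.orderEmbOfFin_mem _ _ _

lemma exists_vertex_eq {e : Edge n d} {i : Fin n} (hi : i ∈ e.1) : ∃ a, vertex a e = i := by
  have : i ∈ Set.range (e.1.orderEmbOfFin e.2) := by
    rw [Finset.range_orderEmbOfFin]; exact hi
  exact this

/-- The similarity matrix is a sum of matrices to each entry of which disjoint sets of edges
contribute. -/
lemma similarityMatrix_eq_sum (w : Edge n d → ℝ) :
    similarityMatrix w =
      ∑ p ∈ (Finset.univ : Finset (Fin d)).offDiag, entryMatrix (vertex p.1) (vertex p.2) w := by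
  ext i j
  rw [Matrix.sum_apply]
  simp only [similarityMatrix, entryMatrix, Matrix.of_apply, Finset.sum_filter]
  rw [Finset.sum_comm]
  -- Exactly one ordered pair of positions of e carries (i, j) if i ≠ j both lie in e, and none does
  -- otherwise.
  have key : ∀ e : Edge n d, ∑ p ∈ (Finset.univ : Finset (Fin d)).offDiag,
      (if vertex p.1 e = i ∧ vertex p.2 e = j then w e else 0) =
      if i ≠ j ∧ {i, j} ⊆ e.1 then w e else 0 := by
    intro e
    split_ifs with h
    · obtain ⟨hij, hsub⟩ := h
      obtain ⟨a, ha⟩ := exists_vertex_eq (hsub (Finset.mem_insert_self i {j}))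
      obtain ⟨b, hb⟩ := exists_vertex_eq (hsub (Finset.mem_insert_of_mem (Finset.mem_singleton_self j)))
      rw [Finset.sum_eq_single (a, b)]
      · simp [ha, hb]
      · rintro ⟨a', b'⟩ - hne
        rw [if_neg]
        rintro ⟨ha', hb'⟩
        exact hne (Prod.ext (vertex_injective e (ha'.trans ha.symm))
          (vertex_injective e (hb'.trans hb.symm)))
      · intro hmem
        refine absurd ?_ hmem
        simp only [Finset.mem_offDiag, Finset.mem_univ, true_and]
        rintro rfl
        exact hij (ha.symm.trans hb)
    · refine Finset.sum_eq_zero fun p hp => if_neg ?_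
      rintro ⟨rfl, rfl⟩
      refine h ⟨fun hv => (Finset.mem_offDiag.1 hp).2.2 (vertex_injective e hv), ?_⟩
      simp [Finset.insert_subset_iff, vertex_mem]
  rw [Finset.sum_congr rfl fun e _ => key e]
  split_ifs with hij
  · simp [hij]
  · simp [hij]

lemma card_filter_pair_subset_le {i j : Fin n} (hij : i ≠ j) :
    (Finset.univ.filter fun e : Edge n d => {i, j} ⊆ e.1).card ≤ (n - 2).choose (d - 2) := by
  have hc : (Finset.univ \ {i, j} : Finset (Fin n)).card = n - 2 := by
    rw [Finset.card_sdiff_of_subset (Finset.subset_univ _), Finset.card_pair hij]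
    simp
  rw [← hc, ← Finset.card_powersetCard]
  refine Finset.card_le_card_of_injOn (fun e => e.1 \ {i, j}) ?_ ?_
  · intro e he
    have he' : {i, j} ⊆ e.1 := by simpa using he
    simp only [Finset.mem_coe, Finset.mem_powersetCard]
    refine ⟨Finset.sdiff_subset_sdiff (Finset.subset_univ _) le_rfl, ?_⟩
    rw [Finset.card_sdiff_of_subset he', Finset.card_pair hij, e.2]
  · intro e he e' he' h
    have h1 : {i, j} ⊆ e.1 := by simpa using he
    have h2 : {i, j} ⊆ e'.1 := by simpa using he'
    refine Subtype.ext ?_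
    rw [← Finset.sdiff_union_of_subset h1, ← Finset.sdiff_union_of_subset h2]
    exact congrArg (· ∪ {i, j}) h

lemma spectralNorm_sum_le {κ : Type*} (s : Finset κ) (M : κ → Matrix (Fin n) (Fin n) ℝ) :
    spectralNorm (∑ p ∈ s, M p) ≤ ∑ p ∈ s, spectralNorm (M p) := by
  unfold spectralNorm
  rw [map_sum]
  exact norm_sum_le _ _

end Hypergraph

/-! ### From position pairs to the block model -/

namespace IsSample

variable {n d k : ℕ} {Ω : Type*} [MeasurableSpace Ω] {P : Measure Ω}
  {p q : ℝ} {Φ : Fin n → Fin k} {W : Edge n d → Ω → ℝ}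

lemma mean_le (h : IsSample P p q Φ W) (hqp : q < p) (e : Edge n d) : ∫ ω, W e ω ∂P ≤ p := by
  by_cases he : IsHomogeneous Φ e
  · exact (h.mean_homogeneous e he).le
  · exact (h.mean_heterogeneous e he).le.trans hqp.le

/-- Distinct positions never meet a diagonal entry; off the diagonal at most (n-2 choose d-2) edges,
each of mean at most p, contribute. -/
lemma isPairSample (h : IsSample P p q Φ W) (hn : 0 < n) (hq : 0 ≤ q) (hqp : q < p) {a b : Fin d}
    (hab : a ≠ b) {ρ : ℕ} (hρ : n * ((n - 2).choose (d - 2) : ℝ) * p ≤ 4 ^ ρ) :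
    IsPairSample P (vertex a) (vertex b) W ρ where
  measurable := h.measurable
  mem_Icc := h.mem_Icc
  indep := h.indep
  mean_le i j := by
    have hp : 0 ≤ p := hq.trans hqp.le
    have hn' : (0 : ℝ) < n := by exact_mod_cast hn
    rcases eq_or_ne i j with rfl | hij
    · rw [Finset.sum_eq_zero]
      · positivity
      · intro e he
        obtain ⟨h1, h2⟩ := (Finset.mem_filter.1 he).2
        exact absurd (vertex_injective e (h1.trans h2.symm)) hab
    · calc ∑ e with vertex a e = i ∧ vertex b e = j, ∫ ω, W e ω ∂P
          ≤ ∑ e : Edge n d with vertex a e = i ∧ vertex b e = j, p :=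
            Finset.sum_le_sum fun e _ => h.mean_le hqp e
        _ ≤ ∑ e : Edge n d with {i, j} ⊆ e.1, p := by
            refine Finset.sum_le_sum_of_subset_of_nonneg (fun e he => ?_) fun _ _ _ => hp
            obtain ⟨rfl, rfl⟩ := (Finset.mem_filter.1 he).2
            simp [Finset.insert_subset_iff, vertex_mem]
        _ ≤ (n - 2).choose (d - 2) * p := by
            rw [Finset.sum_const, nsmul_eq_mul]
            gcongr
            exact card_filter_pair_subset_le hij
        _ ≤ 4 ^ ρ / n := by
            rw [le_div_iff₀ hn']
            linarith

variable [IsProbabilityMeasure P]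

lemma sub_expectedMatrix_eq (h : IsSample P p q Φ W) (ω : Ω) :
    (similarityMatrix fun e => W e ω) -
      expectedMatrix P (fun ω' => similarityMatrix fun e => W e ω') =
      ∑ c ∈ (Finset.univ : Finset (Fin d)).offDiag,
        entryMatrix (vertex c.1) (vertex c.2) fun e => W e ω - ∫ ω', W e ω' ∂P := by
  rw [← similarityMatrix_eq_sum]
  ext i j
  simp only [similarityMatrix, expectedMatrix, Matrix.sub_apply, Matrix.of_apply]
  split_ifs
  · simp
  · rw [integral_finsetSum _ fun e _ =>
      Integrable.of_mem_Icc 0 1 (h.measurable e).aemeasurable (h.mem_Icc e),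
      Finset.sum_sub_distrib]

lemma measureReal_spectralNorm_gt_le (h : IsSample P p q Φ W) (hn : 2 ≤ n) (hq : 0 ≤ q)
    (hqp : q < p) {ρ : ℕ} (hlog : Real.log n ≤ 4 ^ ρ)
    (hρ : n * ((n - 2).choose (d - 2) : ℝ) * p ≤ 4 ^ ρ) (r : ℕ) :
    P.real {ω | ¬ spectralNorm ((similarityMatrix fun e => W e ω) -
      expectedMatrix P (fun ω' => similarityMatrix fun e => W e ω')) ≤
      d ^ 2 * (640 * (r + 3) * 2 ^ ρ)} ≤ d ^ 2 * (12 * ((n : ℝ) ^ r)⁻¹) := by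
  set s := (Finset.univ : Finset (Fin d)).offDiag with hs
  have hcard : (s.card : ℝ) ≤ d ^ 2 := by
    have : s.card ≤ d ^ 2 := by
      rw [hs, Finset.offDiag_card, Finset.card_univ, Fintype.card_fin, sq]
      exact Nat.sub_le _ _
    exact_mod_cast this
  set B : Fin d × Fin d → Set Ω := fun c =>
    {ω | ¬ spectralNorm (entryMatrix (vertex c.1) (vertex c.2)
      fun e => W e ω - ∫ ω', W e ω' ∂P) ≤ 640 * (r + 3) * 2 ^ ρ} with hB
  refine (measureReal_mono (s₂ := ⋃ c ∈ s, B c) ?_ (measure_ne_top P _)).trans ?_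
  · intro ω hω
    by_contra hb
    simp only [hB, Set.mem_iUnion, Set.mem_ofPred_eq, not_exists, not_not] at hb
    refine hω ?_
    rw [h.sub_expectedMatrix_eq ω]
    refine (spectralNorm_sum_le _ _).trans ((Finset.sum_le_sum hb).trans ?_)
    rw [Finset.sum_const, nsmul_eq_mul]
    gcongr
  · refine (measureReal_biUnion_finset_le _ _).trans ((Finset.sum_le_sum fun c hc =>
      (h.isPairSample (by omega) hq hqp (Finset.mem_offDiag.1 hc).2.2
        hρ).measureReal_spectralNorm_gt_le hn hlog r).trans ?_)
    rw [Finset.sum_const, nsmul_eq_mul]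
    gcongr

end IsSample

/-- Of the exponent 2d + 13, the part 2d + 2 absorbs 12 d² < 16 · 4 ^ d ≤ 4 n ^ (2d + 2), leaving
11. -/
lemma sq_mul_inv_pow_lt {n : ℕ} (hn : 2 ≤ n) (d : ℕ) :
    d ^ 2 * (12 * ((n : ℝ) ^ (2 * d + 13))⁻¹) < 4 * (n : ℝ) ^ (-11 : ℤ) := by
  have hn' : (2 : ℝ) ≤ n := by exact_mod_cast hn
  have hd : (d : ℝ) ^ 2 < 4 ^ d := by
    have : d < 2 ^ d := Nat.lt_two_pow_self
    have h : (d : ℝ) < 2 ^ d := by exact_mod_cast this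
    calc (d : ℝ) ^ 2 < (2 ^ d) ^ 2 := by gcongr
      _ = 4 ^ d := by rw [← pow_mul, mul_comm, pow_mul]; norm_num
  have hpow : 4 * (4 : ℝ) ^ d ≤ (n : ℝ) ^ (2 * d + 2) := by
    calc 4 * (4 : ℝ) ^ d = 2 ^ (2 * d + 2) := by rw [pow_add, pow_mul]; norm_num; ring
      _ ≤ _ := by gcongr
  have e1 : (n : ℝ) ^ (-11 : ℤ) = ((n : ℝ) ^ 11)⁻¹ := by
    rw [zpow_neg]; norm_cast
  rw [e1, show 2 * d + 13 = (2 * d + 2) + 11 by ring, pow_add, mul_inv]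
  have h1 : (d : ℝ) ^ 2 * (12 * ((n : ℝ) ^ (2 * d + 2))⁻¹) < 4 := by
    rw [← mul_assoc, ← div_eq_mul_inv, div_lt_iff₀ (by positivity)]
    nlinarith
  calc (d : ℝ) ^ 2 * (12 * (((n : ℝ) ^ (2 * d + 2))⁻¹ * ((n : ℝ) ^ 11)⁻¹)) =
      (d : ℝ) ^ 2 * (12 * ((n : ℝ) ^ (2 * d + 2))⁻¹) * ((n : ℝ) ^ 11)⁻¹ := by ring
    _ < 4 * ((n : ℝ) ^ 11)⁻¹ := by gcongr

/-- Take the first power of 4 above D + 2D/α, which dominates both D and l. The bound l ≥ 1/2 makes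
this number at least 1, so the exponent is natural. -/
lemma exists_four_pow_near {α D l : ℝ} (hα : 0 < α) (hl : 1 / 2 ≤ l) (h : α * l ≤ D) :
    ∃ ρ : ℕ, l ≤ 4 ^ ρ ∧ D ≤ 4 ^ ρ ∧ (2 : ℝ) ^ ρ ≤ 2 * √(1 + 2 / α) * √D := by
  have hD : 0 < D := by nlinarith
  have hlD : l ≤ D / α := by rw [le_div_iff₀ hα]; linarith
  have hb : (1 + 2 / α) * D = D + 2 * (D / α) := by ring
  have h1 : 1 ≤ (1 + 2 / α) * D := by rw [hb]; linarith
  obtain ⟨m, hm1, hm2⟩ := exists_nat_pow_near h1 (by norm_num : (1 : ℝ) < 4)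
  refine ⟨m + 1, ?_, ?_, ?_⟩
  · rw [hb] at hm2; linarith
  · rw [hb] at hm2; linarith
  · rw [mul_assoc, ← Real.sqrt_mul (by positivity), pow_succ, mul_comm]
    gcongr
    refine Real.le_sqrt_of_sq_le ?_
    rwa [← pow_mul, mul_comm, pow_mul, show (2 : ℝ) ^ 2 = 4 by norm_num]

end WHSBM

theorem corollary7p1 (d : ℕ) (hd : 2 ≤ d) (α : ℝ) (hα : 0 < α) :
    ∃ c₅ : ℝ, 0 < c₅ ∧
      ∀ (n k : ℕ) (p q : ℝ) (Φ : Fin n → Fin k), 1 ≤ n → 0 ≤ q → q < p → p ≤ 1 →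
        α * Real.log n ≤ n * ((n - 2).choose (d - 2) : ℝ) * p →
        ∀ (Ω : Type*) [MeasurableSpace Ω] (P : Measure Ω) [IsProbabilityMeasure P]
          (W : WHSBM.Edge n d → Ω → ℝ), WHSBM.IsSample P p q Φ W →
          1 - 4 * (n : ℝ) ^ (-11 : ℤ) <
            P.real {ω | WHSBM.spectralNorm
                (WHSBM.similarityMatrix (fun e => W e ω) -
                  WHSBM.expectedMatrix P fun ω' => WHSBM.similarityMatrix fun e => W e ω')
              ≤ c₅ * Real.sqrt (n * ((n - 2).choose (d - 2) : ℝ) * p)} := by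
  have hd0 : (0 : ℝ) < d := by
    have : 0 < d := by omega
    exact_mod_cast this
  refine ⟨d ^ 2 * (640 * ((2 * d + 13 : ℕ) + 3) * (2 * √(1 + 2 / α))), by positivity, ?_⟩
  intro n k p q Φ hn hq hqp _ hlog Ω _ P _ W hW
  -- For n = 1 the claimed lower bound is 1 - 4 < 0.
  rcases hn.eq_or_lt with rfl | hn2
  · have : (0 : ℝ) ≤ P.real {ω | WHSBM.spectralNorm
        (WHSBM.similarityMatrix (fun e => W e ω) -
          WHSBM.expectedMatrix P fun ω' => WHSBM.similarityMatrix fun e => W e ω') ≤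
        d ^ 2 * (640 * ((2 * d + 13 : ℕ) + 3) * (2 * √(1 + 2 / α))) *
          Real.sqrt ((1 : ℕ) * ((1 - 2).choose (d - 2) : ℝ) * p)} := measureReal_nonneg
    refine lt_of_lt_of_le ?_ this
    norm_num
  set D : ℝ := n * ((n - 2).choose (d - 2) : ℝ) * p with hD
  have hl : 1 / 2 ≤ Real.log n := by
    have h2 : Real.log 2 ≤ Real.log n :=
      Real.log_le_log two_pos (by exact_mod_cast hn2)
    linarith [Real.log_two_gt_d9]
  obtain ⟨ρ, h1, h2, h3⟩ := WHSBM.exists_four_pow_near hα hl hlog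
  have hbad := hW.measureReal_spectralNorm_gt_le hn2 hq hqp h1 h2 (2 * d + 13)
  have hlt := WHSBM.sq_mul_inv_pow_lt hn2 d
  set X : Ω → ℝ := fun ω => WHSBM.spectralNorm
    (WHSBM.similarityMatrix (fun e => W e ω) -
      WHSBM.expectedMatrix P fun ω' => WHSBM.similarityMatrix fun e => W e ω') with hX
  -- Subadditivity on a cover of the whole space replaces passing to the complement, so
  -- measurability of the norm event is not needed.
  have hcover : (Set.univ : Set Ω) ⊆
      {ω | X ω ≤ d ^ 2 * (640 * ((2 * d + 13 : ℕ) + 3) * (2 * √(1 + 2 / α))) * √D} ∪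
      {ω | ¬ X ω ≤ d ^ 2 * (640 * ((2 * d + 13 : ℕ) + 3) * 2 ^ ρ)} := by
    intro ω _
    by_cases hω : X ω ≤ d ^ 2 * (640 * ((2 * d + 13 : ℕ) + 3) * 2 ^ ρ)
    · left
      refine hω.trans ?_
      calc _ ≤ (d : ℝ) ^ 2 * (640 * ((2 * d + 13 : ℕ) + 3) * (2 * √(1 + 2 / α) * √D)) := by gcongr
        _ = _ := by ring
    · exact Or.inr hω
  have h4 := (measureReal_mono (μ := P) hcover).trans (measureReal_union_le _ _)
  rw [probReal_univ] at h4
  linarith
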